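/- For $n\in\mathbb N$ let $z_0<\dots<z_n$ be either the uniform partition $U_n=(-1+2j/n)_{j=0}^n$ or the Chebyshev partition $Ch_n=(-\cos(j\pi/n))_{j=0}^n$ of $[-1,1]$. Put $z_{-1}:=z_0$, $z_{n+1}:=z_n$ and $\mathcal J_j:=\left[\tfrac{z_{j-1}+z_j}{2},\tfrac{z_j+z_{j+1}}{2}\right]$, $0\le j\le n$. A function is a piecewise polynomial of degree $d$ on a partition of $[-1,1]$ if it coincides with a polynomial of degree at most $d$ on each open interval between consecutive knots; it is a spline of minimal defect of degree $d$ if, in addition, it belongs to $C^{d-1}[-1,1]$. A function is $q$-monotone on $[-1,1]$ if all its divided differences of order $q$ at $q+1$ distinct points of $[-1,1]$ are nonnegative. For a closed interval $J$ of length $|J|$ and $0<p\le\infty$, let $$\omega_k(f,J)_p:=\sup_{0<h\le |J|}\|\Delta_h^k(f,\cdot,J)\|_{L_p(J)},$$ where $\Delta_h^k(f,x,J):=\sum_{i=0}^k\binom ki(-1)^{k-i}f(x-kh/2+ih)$ if $x\pm kh/2\in J$, and $\Delta_h^k(f,x,J):=0$ otherwise; here $\|g\|_{L_p(J)}=(\int_J|g|^p)^{1/p}$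 for $p<\infty$ and $\|g\|_{L_\infty(J)}=\operatorname{ess\,sup}_J|g|$. **Corollary 1.3.** Let $q,r\in\mathbb N=\{1,2,\dots\}$. There are a constant $m_0=m_0(q,r)>0$ and, for each $0<p\le\infty$, a constant $c(p,q,r)<\infty$ such that the following holds for both families of partitions. For every $n\in\mathbb N$, every $q$-monotone piecewise polynomial $s\in C^{q-1}[-1,1]$ of degree $q+r$ on $U_n$ (respectively, $Ch_n$) and every integer $m\ge m_0 n$, there is a $q$-monotone spline $\tilde s$ of minimal defect of degree $q+r$ on $U_m$ (respectively, $Ch_m$), not depending on $p$, such that $$\|s-\tilde s\|_{L_p(\mathcal J_j)}\le c(p,q,r)\,\omega_{q+r+1}(s,\mathcal J_j)_p,\qquad 0\le j\le n,$$ for all $0<p\le\infty$. -/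

import Mathlib

open Set MeasureTheory
open scoped ENNReal NNReal

namespace SplineSmoothing

noncomputable section

/-- The divided difference `[f; t₀, …, t_q]` of order `q` of `f` at the points `t`
(meaningful for pairwise distinct points). -/
def dividedDifference {q : ℕ} (f : ℝ → ℝ) (t : Fin (q + 1) → ℝ) : ℝ :=
  ∑ i, f (t i) / ∏ j ∈ Finset.univ.erase i, (t i - t j)

/-- `f ∈ Δ^q(J)`: the divided differences of order `q` of `f` at any `q + 1` distinct points
of `J` are nonnegative. -/
def IsQMonotoneOn (q : ℕ) (f : ℝ → ℝ) (J : Set ℝ) : Prop :=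
  ∀ t : Fin (q + 1) → ℝ, Function.Injective t → (∀ i, t i ∈ J) → 0 ≤ dividedDifference f t

/-- The symmetric difference `Δ_h^k(f, x, J)`, equal to `0` unless both `x - kh/2` and
`x + kh/2` belong to `J`. -/
def symmDifference (k : ℕ) (h : ℝ) (f : ℝ → ℝ) (J : Set ℝ) : ℝ → ℝ :=
  indicator {x | x - k * h / 2 ∈ J ∧ x + k * h / 2 ∈ J} fun x =>
    ∑ i ∈ Finset.range (k + 1),
      (k.choose i : ℝ) * (-1) ^ (k - i) * f (x - k * h / 2 + i * h)

/-- The `L_p(J)` (quasi)norm, for `0 < p ≤ ∞`. -/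
def LpNormOn (f : ℝ → ℝ) (p : ℝ≥0∞) (J : Set ℝ) : ℝ≥0∞ :=
  eLpNorm f p (volume.restrict J)

/-- The `k`-th modulus of smoothness `ω_k(f, t, J)_p`. -/
def modulusOfSmoothness (k : ℕ) (f : ℝ → ℝ) (t : ℝ) (J : Set ℝ) (p : ℝ≥0∞) : ℝ≥0∞ :=
  ⨆ h ∈ Ioc (0 : ℝ) t, LpNormOn (symmDifference k h f J) p J

/-- `ω_k(f, J)_p = ω_k(f, |J|, J)_p`, where `|J|` is the length of `J`. -/
def localModulus (k : ℕ) (f : ℝ → ℝ) (J : Set ℝ) (p : ℝ≥0∞) : ℝ≥0∞ :=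
  modulusOfSmoothness k f (volume.real J) J p

/-- The knots `z_j = -1 + 2j/n` (`0 ≤ j ≤ n`) of the uniform partition of `[-1, 1]`. -/
def uniformKnot (n j : ℕ) : ℝ := -1 + 2 * (j : ℝ) / n

/-- The knots `z_j = -cos(jπ/n)` (`0 ≤ j ≤ n`) of the Chebyshev partition of `[-1, 1]`. -/
def chebyshevKnot (n j : ℕ) : ℝ := -Real.cos ((j : ℝ) * Real.pi / n)

/-- `s` is a piecewise polynomial function of degree `≤ d` with the knots `z 0 < … < z n`. -/
def IsPiecewisePoly (d n : ℕ) (z : ℕ → ℝ) (s : ℝ → ℝ) : Prop :=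
  ∀ i < n, ∃ P : Polynomial ℝ, P.natDegree ≤ d ∧
    ∀ x ∈ Ioo (z i) (z (i + 1)), s x = P.eval x

/-- `s` is a spline of minimal defect of degree `≤ d` with the knots `-1 = z 0 < … < z n = 1`:
a piecewise polynomial function which belongs to `C^{d-1}[-1, 1]` (for `d = 0` no smoothness
is required). -/
def IsMinimalDefectSpline (d n : ℕ) (z : ℕ → ℝ) (s : ℝ → ℝ) : Prop :=
  IsPiecewisePoly d n z s ∧ ∀ k : ℕ, k < d → ContDiffOn ℝ k s (Icc (-1) 1)

/-- The interval `𝒥_j = [(z_{j-1} + z_j)/2, (z_j + z_{j+1})/2]`, `0 ≤ j ≤ n`, with the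
convention `z_{-1} = z_0` (here `0 - 1 = 0`) and `z_{n+1} = z_n`. -/
def localInterval (n : ℕ) (z : ℕ → ℝ) (j : ℕ) : Set ℝ :=
  Icc ((z (j - 1) + z j) / 2) ((z j + z (min (j + 1) n)) / 2)

end

end SplineSmoothing

namespace SplineSmoothing

open Polynomial

/-! Let `P₁`, `P₂` be the pieces of `s` on the two sides of an interior knot, and let `D = P₂ - P₁`.
Since `s` is `C^(q-1)`, `D` vanishes to order `q` at the knot. After rescaling the knot to 0 and the
half gap to 1, let `M` be the sum of the absolute values of the coefficients of `D`. Everything is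
measured against `M`.

The abrupt jump `D·1_{x>0}` is replaced by a spline `∑ μ_t (x-t)_+^(q+r)` whose knots `t` are new
knots in `[0, R]` and whose full polynomial sum is `D` (`exists_polyOf_eq`). The order of vanishing
of `D` limits the masses to `O(M R^(-r))`. Hence the `q`-th derivative of the result is nonnegative
off `[0, R]` and at least `-C·M` on `[0, R]`, with `C` independent of `R`.

This defect is repaired by `exists_correction`. A B-spline, seen as a `q`-th derivative, is positive
and of size about `1/R` on `[0, R]`. A measure on a distant interval `I` cancels its moments up to
degree `q+r`, so the correction has compact support. The cancelling part has a bound independent of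
`R`. By `exists_Icc_jump_le`, `I` can be chosen where the `q`-th derivative of one of the pieces is
at least `cM`: both are nonnegative on their own sides, and they cannot both be small compared with
their difference. Adding the correction times a multiple of `RM` covers the defect on `[0, R]` and
costs only `O(RM)` on `I`, so a small fixed `R` suffices (`exists_smoothing_measure`).

The transitions at different knots do not interfere, and their sum is the required spline
(`exists_smoothing`). The error is `O(M)` near each knot. Conversely, a difference of order `q+r+1`
with only its last node beyond the knot equals a value of `D`, so the local modulus is at least a
constant times `M` times the matching power of the gap (`exists_jump_le_localModulus`). The
construction never involves `p`. -/

/-! ### Divided differences and derivatives. -/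

/-- Iterated Rolle theorem: a `C^n` function with `n + 1` zeros in `[a, b]` has a zero of its
`n`-th derivative there. -/
theorem exists_iteratedDeriv_eq_zero (n : ℕ) {a b : ℝ} {F : ℝ → ℝ} (hF : ContDiff ℝ n F)
    {x : Fin (n + 1) → ℝ} (hx : StrictMono x) (hab : ∀ i, x i ∈ Icc a b) (h0 : ∀ i, F (x i) = 0) :
    ∃ ξ ∈ Icc a b, iteratedDeriv n F ξ = 0 := by
  induction n generalizing F with
  | zero => exact ⟨x 0, hab 0, by simpa using h0 0⟩
  | succ n ih =>
    have hy : ∀ i : Fin (n + 1), ∃ y ∈ Ioo (x i.castSucc) (x i.succ), deriv F y = 0 := fun i =>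
      exists_deriv_eq_zero (hx (Fin.castSucc_lt_succ)) hF.continuous.continuousOn
        (by rw [h0, h0])
    choose y hy hy0 using hy
    have hmono : StrictMono y := by
      intro i j hij
      have h1 : x i.succ ≤ x j.castSucc := hx.monotone (by
        rw [Fin.le_def]; simpa using hij)
      exact (hy i).2.trans_le (h1.trans (hy j).1.le)
    have hF' : ContDiff ℝ n (deriv F) := by
      have : ContDiff ℝ ((n : WithTop ℕ∞) + 1) F := by exact_mod_cast hF
      exact (contDiff_succ_iff_deriv.1 this).2.2
    obtain ⟨ξ, hξ, h⟩ := ih hF' hmono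
      (fun i => ⟨(hab _).1.trans (hy i).1.le, (hy i).2.le.trans (hab _).2⟩) hy0
    exact ⟨ξ, hξ, by rw [iteratedDeriv_succ', h]⟩

theorem iteratedDeriv_polynomial_eval (P : ℝ[X]) (n : ℕ) :
    iteratedDeriv n (fun x => P.eval x) = fun x => (derivative^[n] P).eval x := by
  induction n generalizing P with
  | zero => simp
  | succ n ih =>
    have : deriv (fun x => P.eval x) = fun x => (derivative P).eval x := by
      ext x; exact P.deriv
    rw [iteratedDeriv_succ', this, ih]
    simp

theorem contDiff_polynomial_eval (P : ℝ[X]) (n : WithTop ℕ∞) : ContDiff ℝ n fun x => P.eval x := by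
  simpa using P.contDiff_aeval (𝕜 := ℝ) n

/-- The divided difference of `φ` at the points of a finite set. -/
noncomputable def divDiff (s : Finset ℝ) (φ : ℝ → ℝ) : ℝ :=
  ∑ x ∈ s, φ x / ∏ y ∈ s.erase x, (x - y)

theorem divDiff_congr {s : Finset ℝ} {φ ψ : ℝ → ℝ} (h : ∀ x ∈ s, φ x = ψ x) :
    divDiff s φ = divDiff s ψ :=
  Finset.sum_congr rfl fun x hx => by rw [h x hx]

theorem divDiff_add (s : Finset ℝ) (φ ψ : ℝ → ℝ) :
    divDiff s (fun x => φ x + ψ x) = divDiff s φ + divDiff s ψ := by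
  simp [divDiff, add_div, Finset.sum_add_distrib]

theorem divDiff_const_mul (s : Finset ℝ) (a : ℝ) (φ : ℝ → ℝ) :
    divDiff s (fun x => a * φ x) = a * divDiff s φ := by
  simp [divDiff, Finset.mul_sum, mul_div_assoc]

theorem divDiff_polynomial {s : Finset ℝ} {P : ℝ[X]} (hP : P.degree < s.card) :
    divDiff s (fun x => P.eval x) = P.coeff (s.card - 1) := by
  have := Lagrange.coeff_eq_sum (s := s) (v := id) (Function.injective_id.injOn) hP
  simpa [divDiff] using this.symm

/-- Mean value theorem: `φ` minus its Lagrange interpolant vanishes at `n + 1` points, so Rolle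
applies. The `n`-th derivative of the interpolant is the constant `n!` times its leading
coefficient, which is the divided difference. -/
theorem divDiff_eq_iteratedDeriv {n : ℕ} {s : Finset ℝ} (hs : s.card = n + 1) {a b : ℝ}
    (hab : ∀ x ∈ s, x ∈ Icc a b) {φ : ℝ → ℝ} (hφ : ContDiff ℝ n φ) :
    ∃ ξ ∈ Icc a b, divDiff s φ = iteratedDeriv n φ ξ / n.factorial := by
  set P : ℝ[X] := Lagrange.interpolate s id φ with hPdef
  have hinj : Set.InjOn (id : ℝ → ℝ) s := Function.injective_id.injOn
  have hdeg : P.degree < s.card := Lagrange.degree_interpolate_lt _ hinj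
  have heval : ∀ x ∈ s, P.eval x = φ x := fun x hx =>
    Lagrange.eval_interpolate_at_node (v := id) φ hinj hx
  have hPc : ContDiff ℝ n (fun x => P.eval x) := contDiff_polynomial_eval P n
  obtain ⟨ξ, hξ, h⟩ := exists_iteratedDeriv_eq_zero n (a := a) (b := b) (hφ.sub hPc)
    (s.orderEmbOfFin hs).strictMono (fun i => hab _ (s.orderEmbOfFin_mem hs i))
    (fun i => by
      have := heval _ (s.orderEmbOfFin_mem hs i)
      simp [this])
  refine ⟨ξ, hξ, ?_⟩
  have hsub := iteratedDeriv_sub (n := n) (x := ξ) hφ.contDiffAt hPc.contDiffAt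
  have h' : iteratedDeriv n φ ξ = (derivative^[n] P).eval ξ := by
    have h2 := congrFun (iteratedDeriv_polynomial_eval P n) ξ
    rw [← h2]
    rw [← sub_eq_zero, ← hsub]
    exact h
  have hnd : P.natDegree ≤ n := by
    rw [hs] at hdeg
    exact natDegree_le_iff_coeff_eq_zero.2 fun N hN =>
      coeff_eq_zero_of_degree_lt (hdeg.trans_le (by exact_mod_cast hN))
  have hconst : derivative^[n] P = C (n.factorial * P.coeff n : ℝ) := by
    have h0 : (derivative^[n] P).natDegree ≤ 0 := by
      refine (natDegree_iterate_derivative P n).trans (by omega)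
    rw [eq_C_of_natDegree_le_zero h0, coeff_iterate_derivative]
    simp [Nat.descFactorial_self, nsmul_eq_mul]
  have hdd : divDiff s φ = P.coeff n := by
    rw [divDiff_congr fun x hx => (heval x hx).symm, divDiff_polynomial hdeg, hs]
    rfl
  rw [hdd, h', hconst, eval_C, mul_div_cancel_left₀]
  exact_mod_cast n.factorial_ne_zero

theorem dividedDifference_eq_divDiff {q : ℕ} (f : ℝ → ℝ) {t : Fin (q + 1) → ℝ}
    (ht : Function.Injective t) :
    dividedDifference f t = divDiff (Finset.univ.map ⟨t, ht⟩) f := by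
  unfold dividedDifference divDiff
  rw [Finset.sum_map]
  refine Finset.sum_congr rfl fun i _ => ?_
  rw [← Finset.map_erase, Finset.prod_map]
  rfl

theorem isQMonotoneOn_of_iteratedDeriv_nonneg {q : ℕ} {a b : ℝ} {f : ℝ → ℝ}
    (hf : ContDiff ℝ q f) (h : ∀ x ∈ Icc a b, 0 ≤ iteratedDeriv q f x) :
    IsQMonotoneOn q f (Icc a b) := by
  intro t ht hmem
  rw [dividedDifference_eq_divDiff f ht]
  obtain ⟨ξ, hξ, h'⟩ := divDiff_eq_iteratedDeriv (n := q) (s := Finset.univ.map ⟨t, ht⟩)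
    (by simp) (a := a) (b := b) (by simpa using hmem) hf
  rw [h']
  exact div_nonneg (h ξ hξ) (by positivity)

/-- A negative value of the `q`-th derivative at an interior point persists on a short interval; `q
+ 1` points chosen there have a negative divided difference by the mean value theorem. The endpoints
follow by closure. -/
theorem IsQMonotoneOn.iterate_derivative_nonneg {q : ℕ} {J : Set ℝ} {s : ℝ → ℝ}
    (hs : IsQMonotoneOn q s J) {u v : ℝ} (huv : u < v) {P : ℝ[X]} (hJ : Ioo u v ⊆ J)
    (hP : ∀ x ∈ Ioo u v, s x = P.eval x) {x : ℝ} (hx : x ∈ Icc u v) :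
    0 ≤ (derivative^[q] P).eval x := by
  suffices hoo : Ioo u v ⊆ {y | 0 ≤ (derivative^[q] P).eval y} by
    have hcl : IsClosed {y | 0 ≤ (derivative^[q] P).eval y} :=
      isClosed_le continuous_const (derivative^[q] P).continuous
    have := closure_minimal hoo hcl
    rw [closure_Ioo huv.ne] at this
    exact this hx
  intro y hy
  by_contra hneg
  have hneg : (derivative^[q] P).eval y < 0 := not_le.1 hneg
  have hopen : IsOpen (Ioo u v ∩ {y | (derivative^[q] P).eval y < 0}) :=
    isOpen_Ioo.inter (isOpen_lt (derivative^[q] P).continuous continuous_const)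
  obtain ⟨ε, hε, hball⟩ := Metric.isOpen_iff.1 hopen y ⟨hy, hneg⟩
  have hsub : ∀ z ∈ Icc y (y + ε / 2), z ∈ Ioo u v ∩ {y | (derivative^[q] P).eval y < 0} := by
    intro z hz
    refine hball ?_
    rw [Metric.mem_ball, Real.dist_eq, abs_of_nonneg (by linarith [hz.1])]
    linarith [hz.2]
  let t : Fin (q + 1) → ℝ := fun i => y + ε / 2 * (i / (q + 1))
  have ht : Function.Injective t := by
    intro i j hij
    have h1 : ε / 2 * ((i : ℝ) / (q + 1)) = ε / 2 * ((j : ℝ) / (q + 1)) := by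
      simpa [t] using hij
    have h2 := mul_left_cancel₀ (by positivity) h1
    rw [div_left_inj' (by positivity)] at h2
    exact Fin.ext (by exact_mod_cast h2)
  have htm : ∀ i, t i ∈ Icc y (y + ε / 2) := by
    intro i
    have h1 : (0 : ℝ) ≤ (i : ℝ) / (q + 1) := by positivity
    have h2 : (i : ℝ) / (q + 1) ≤ 1 := by
      rw [div_le_one (by positivity)]
      have : (i : ℕ) ≤ q := by omega
      have : ((i : ℕ) : ℝ) ≤ q := by exact_mod_cast this
      linarith
    constructor <;> simp only [t] <;> nlinarith
  have h0 := hs t ht fun i => hJ (hsub _ (htm i)).1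
  rw [dividedDifference_eq_divDiff s ht] at h0
  rw [divDiff_congr (ψ := fun x => P.eval x) (by
    intro x hx
    obtain ⟨i, -, rfl⟩ := Finset.mem_map.1 hx
    exact hP _ (hsub _ (htm i)).1)] at h0
  obtain ⟨ξ, hξ, h'⟩ := divDiff_eq_iteratedDeriv (n := q) (s := Finset.univ.map ⟨t, ht⟩)
    (by simp) (a := y) (b := y + ε / 2) (by simpa using htm) (φ := fun x => P.eval x) (contDiff_polynomial_eval P _)
  rw [h', iteratedDeriv_polynomial_eval] at h0
  have := (hsub ξ hξ).2
  simp only [mem_ofPred_eq] at this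
  exact absurd h0 (not_le.2 (div_neg_of_neg_of_pos this (by positivity)))

/-! ### B-splines as divided differences of truncated powers. -/

/-- Multiplying the term at `x` by `x - c` cancels one factor of its denominator and kills the term
`x = c`, which leaves the divided difference without `c`. Subtract the cases `c = a` and `c = b`. -/
theorem divDiff_recurrence {s : Finset ℝ} {a b : ℝ} (ha : a ∈ s) (hb : b ∈ s) 
    (φ : ℝ → ℝ) :
    (b - a) * divDiff s φ = divDiff (s.erase a) φ - divDiff (s.erase b) φ := by
  have key : ∀ c ∈ s, divDiff (s.erase c) φ
      = ∑ x ∈ s, (x - c) * (φ x / ∏ y ∈ s.erase x, (x - y)) := by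
    intro c hc
    rw [← Finset.add_sum_erase s _ hc]
    simp only [sub_self, zero_mul, zero_add]
    refine Finset.sum_congr rfl fun x hx => ?_
    have hxc : c ∈ s.erase x := Finset.mem_erase.2 ⟨(Finset.ne_of_mem_erase hx).symm, hc⟩
    rw [← Finset.mul_prod_erase _ _ hxc, Finset.erase_right_comm]
    have : x - c ≠ 0 := sub_ne_zero.2 (Finset.ne_of_mem_erase hx)
    field_simp
  rw [key a ha, key b hb, divDiff, ← Finset.sum_sub_distrib, Finset.mul_sum]
  exact Finset.sum_congr rfl fun x _ => by ring

theorem divDiff_sub_mul {s : Finset ℝ} {c : ℝ} (hc : c ∈ s) (φ : ℝ → ℝ) :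
    divDiff s (fun x => (x - c) * φ x) = divDiff (s.erase c) φ := by
  unfold divDiff
  rw [← Finset.add_sum_erase s _ hc]
  simp only [sub_self, zero_mul, zero_add, zero_div]
  refine Finset.sum_congr rfl fun x hx => ?_
  have hxc : c ∈ s.erase x := Finset.mem_erase.2 ⟨(Finset.ne_of_mem_erase hx).symm, hc⟩
  rw [← Finset.mul_prod_erase _ _ hxc, Finset.erase_right_comm]
  have : x - c ≠ 0 := sub_ne_zero.2 (Finset.ne_of_mem_erase hx)
  rw [mul_div_mul_left _ _ this]

/-- `(t - x)_+^k`, as a function of `t`. -/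
noncomputable def upperPow (k : ℕ) (x t : ℝ) : ℝ := if x < t then (t - x) ^ k else 0

theorem divDiff_upperPow_of_le {s : Finset ℝ} {x : ℝ} (h : ∀ t ∈ s, t ≤ x) (k : ℕ) :
    divDiff s (upperPow k x) = 0 :=
  Finset.sum_eq_zero fun t ht => by simp [upperPow, not_lt.2 (h t ht)]

theorem divDiff_polynomial_eq_zero {s : Finset ℝ} {P : ℝ[X]} (hP : P.natDegree + 1 < s.card) :
    divDiff s (fun x => P.eval x) = 0 := by
  rw [divDiff_polynomial (degree_le_natDegree.trans_lt (by norm_cast; omega))]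
  exact coeff_eq_zero_of_natDegree_lt (by omega)

/-- To the left of all knots the truncation is inactive, and a divided difference of order `r + 1`
kills degree `r`. For `r = 0` the convention at `t = x` would break this. -/
theorem divDiff_upperPow_of_ge {r : ℕ} {s : Finset ℝ} (hs : s.card = r + 2) {x : ℝ}
    (h : ∀ t ∈ s, x ≤ t) (hr : r ≠ 0) : divDiff s (upperPow r x) = 0 := by
  have h1 : ∀ t ∈ s, upperPow r x t = ((X - C x) ^ r : ℝ[X]).eval t := by
    intro t ht
    rcases (h t ht).lt_or_eq with h2 | h2
    · simp [upperPow, h2]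
    · simp [upperPow, h2, hr]
  rw [divDiff_congr h1, divDiff_polynomial_eq_zero (by simp [hs])]

/-- The Cox–de Boor recurrence. Write `t - x = (t - c) + (c - x)`, with `c = b` when `a` is removed
and `c = a` when `b` is removed; the two `t - c` parts both reduce to the divided difference without
`a` and `b`, and cancel. -/
theorem divDiff_upperPow_succ {r : ℕ} {s : Finset ℝ} {a b : ℝ} (ha : a ∈ s) (hb : b ∈ s)
    (hab : a ≠ b) (x : ℝ) :
    (b - a) * divDiff s (upperPow (r + 1) x)
      = (b - x) * divDiff (s.erase a) (upperPow r x)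
        + (x - a) * divDiff (s.erase b) (upperPow r x) := by
  have hmul : ∀ c : ℝ, upperPow (r + 1) x
      = fun t => (t - c) * upperPow r x t + (c - x) * upperPow r x t := by
    intro c
    ext t
    unfold upperPow
    split_ifs <;> ring
  have hba : b ∈ s.erase a := Finset.mem_erase.2 ⟨hab.symm, hb⟩
  have hab' : a ∈ s.erase b := Finset.mem_erase.2 ⟨hab, ha⟩
  rw [divDiff_recurrence ha hb]
  nth_rewrite 1 [hmul b]
  rw [hmul a, divDiff_add, divDiff_add, divDiff_const_mul, divDiff_const_mul,
    divDiff_sub_mul hba, divDiff_sub_mul hab', Finset.erase_right_comm]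
  ring

/-- Nonnegativity of B-splines. -/
theorem divDiff_upperPow_nonneg (r : ℕ) {s : Finset ℝ} (hs : s.card = r + 2) (x : ℝ) :
    0 ≤ divDiff s (upperPow r x) := by
  induction r generalizing s with
  | zero =>
    obtain ⟨a, b, hab, rfl⟩ := Finset.card_eq_two.1 hs
    wlog hlt : a < b generalizing a b
    · rw [Finset.pair_comm]
      exact this b a hab.symm (by rw [Finset.pair_comm]; exact hs)
        (lt_of_le_of_ne (not_lt.1 hlt) hab.symm)
    have h1 : divDiff {a, b} (upperPow 0 x) = (upperPow 0 x b - upperPow 0 x a) / (b - a) := by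
      have h2 : a - b ≠ 0 := sub_ne_zero.2 hab
      have h3 : b - a ≠ 0 := sub_ne_zero.2 hab.symm
      have e1 : ({a, b} : Finset ℝ).erase a = {b} := by
        ext y; simp only [Finset.mem_erase, Finset.mem_insert, Finset.mem_singleton]; grind
      have e2 : ({a, b} : Finset ℝ).erase b = {a} := by
        ext y; simp only [Finset.mem_erase, Finset.mem_insert, Finset.mem_singleton]; grind
      rw [divDiff, Finset.sum_pair hab, e1, e2, Finset.prod_singleton, Finset.prod_singleton]
      field_simp
      ring
    rw [h1]
    refine div_nonneg ?_ (by linarith)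
    unfold upperPow
    split_ifs <;> linarith
  | succ r ih =>
    have hne : s.Nonempty := Finset.card_pos.1 (by omega)
    obtain ⟨a, ha, hamin⟩ : ∃ a ∈ s, ∀ t ∈ s, a ≤ t := ⟨_, s.min'_mem hne, s.min'_le⟩
    obtain ⟨b, hb, hbmax⟩ : ∃ b ∈ s, ∀ t ∈ s, t ≤ b := ⟨_, s.max'_mem hne, s.le_max'⟩
    have hab : a < b := by
      refine lt_of_le_of_ne (hamin b hb) fun h => ?_
      have : s ⊆ {a} := fun t ht =>
        Finset.mem_singleton.2 (le_antisymm (h ▸ hbmax t ht) (hamin t ht))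
      have := Finset.card_le_card this
      simp at this
      omega
    rcases le_total x a with hxa | hxa
    · rw [divDiff_upperPow_of_ge hs (fun t ht => hxa.trans (hamin t ht)) (by omega)]
    rcases le_total b x with hxb | hxb
    · rw [divDiff_upperPow_of_le fun t ht => (hbmax t ht).trans hxb]
    -- Between the extreme knots both weights in the recurrence are nonnegative.
    have h1 := divDiff_upperPow_succ (r := r) ha hb hab.ne x
    have h2 : 0 ≤ (b - x) * divDiff (s.erase a) (upperPow r x) :=
      mul_nonneg (by linarith) (ih (by rw [Finset.card_erase_of_mem ha]; omega))
    have h3 : 0 ≤ (x - a) * divDiff (s.erase b) (upperPow r x) :=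
      mul_nonneg (by linarith) (ih (by rw [Finset.card_erase_of_mem hb]; omega))
    exact nonneg_of_mul_nonneg_right (by linarith) (sub_pos.2 hab)

/-- The B-spline on its first knot interval. -/
theorem divDiff_upperPow_first {r : ℕ} {s : Finset ℝ} {a : ℝ} (ha : a ∈ s)
    (hs : s.card = r + 2) {x : ℝ} (hax : a ≤ x) (hx : ∀ t ∈ s.erase a, x < t) :
    divDiff s (upperPow r x) = (x - a) ^ r / ∏ t ∈ s.erase a, (t - a) := by
  -- The untruncated power has zero divided difference, and truncation removes only the term at `a`;
  -- so the value is minus that term.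
  have h0 := divDiff_polynomial_eq_zero (s := s) (P := (X - C x) ^ r) (by simp [hs])
  rw [divDiff, ← Finset.add_sum_erase s _ ha] at h0 ⊢
  have h1 : upperPow r x a = 0 := by simp [upperPow, hax]
  have h2 : ∑ t ∈ s.erase a, upperPow r x t / ∏ y ∈ s.erase t, (t - y)
      = ∑ t ∈ s.erase a, ((X - C x) ^ r : ℝ[X]).eval t / ∏ y ∈ s.erase t, (t - y) :=
    Finset.sum_congr rfl fun t ht => by simp [upperPow, hx t ht]
  rw [h1, h2, zero_div, zero_add, ← neg_eq_iff_add_eq_zero.2 h0]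
  have h3 : ∏ y ∈ s.erase a, (a - y) = (-1) ^ (r + 1) * ∏ y ∈ s.erase a, (y - a) := by
    rw [show r + 1 = (s.erase a).card by rw [Finset.card_erase_of_mem ha]; omega,
      ← Finset.prod_const, ← Finset.prod_mul_distrib]
    exact Finset.prod_congr rfl fun y _ => by ring
  have h4 : (a - x) ^ r = (-1) ^ r * (x - a) ^ r := by rw [← mul_pow]; ring
  rw [h3]
  simp only [eval_pow, eval_sub, eval_X, eval_C]
  rw [h4, pow_succ, mul_assoc, mul_div_mul_left _ _ (pow_ne_zero _ (by norm_num))]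
  rw [neg_one_mul, div_neg, neg_neg]

/-! ### Truncated powers and splines generated by discrete measures. -/

/-- The truncated power `(x - t)_+^k`. -/
noncomputable def truncPow (k : ℕ) (t x : ℝ) : ℝ := if t < x then (x - t) ^ k else 0

theorem upperPow_add_truncPow {r : ℕ} (hr : r ≠ 0) (t x : ℝ) :
    upperPow r x t + (-1) ^ r * truncPow r t x = (t - x) ^ r := by
  unfold upperPow truncPow
  rcases lt_trichotomy t x with h | rfl | h
  · rw [if_neg (not_lt.2 h.le), if_pos h, ← mul_pow]; ring
  · simp [hr]
  · rw [if_pos h, if_neg (not_lt.2 h.le)]; ring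

theorem truncPow_of_le {k : ℕ} {t x : ℝ} (h : x ≤ t) : truncPow k t x = 0 := by
  simp [truncPow, h]

theorem truncPow_of_ge {k : ℕ} (hk : k ≠ 0) {t x : ℝ} (h : t ≤ x) :
    truncPow k t x = (x - t) ^ k := by
  rcases h.lt_or_eq with h | rfl
  · simp [truncPow, h]
  · simp [truncPow, hk]

theorem abs_truncPow_le {k : ℕ} {t x L : ℝ} (hL : 0 ≤ L) (h : x - t ≤ L) :
    |truncPow k t x| ≤ L ^ k := by
  unfold truncPow
  split_ifs with h1
  · rw [abs_of_nonneg (pow_nonneg (by linarith) k)]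
    exact pow_le_pow_left₀ (by linarith) h k
  · simp [hL]

theorem continuous_truncPow (k : ℕ) (t : ℝ) : Continuous (truncPow (k + 1) t) := by
  have : truncPow (k + 1) t = fun x => (max (x - t) 0) ^ (k + 1) := by
    ext x
    rcases le_total x t with h | h
    · rw [truncPow_of_le h, max_eq_right (by linarith)]; simp
    · rw [truncPow_of_ge (by omega) h, max_eq_left (by linarith)]
  rw [this]
  fun_prop

/-- Clear away from `t`. At `t` it follows because the function and the candidate derivative are
both continuous there. -/
theorem hasDerivAt_truncPow (k : ℕ) (t x : ℝ) :
    HasDerivAt (truncPow (k + 2) t) ((k + 2 : ℕ) * truncPow (k + 1) t x) x := by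
  have hne : ∀ y ≠ t, HasDerivAt (truncPow (k + 2) t) ((k + 2 : ℕ) * truncPow (k + 1) t y) y := by
    intro y hy
    rcases lt_or_gt_of_ne hy with h | h
    · rw [truncPow_of_le h.le, mul_zero]
      refine (hasDerivAt_const y (0 : ℝ)).congr_of_eventuallyEq ?_
      filter_upwards [Iio_mem_nhds h] with z hz
      exact truncPow_of_le (le_of_lt hz)
    · rw [truncPow_of_ge (by omega) h.le]
      have h1 : HasDerivAt (fun z => (z - t) ^ (k + 2)) ((k + 2 : ℕ) * (y - t) ^ (k + 1)) y := by
        simpa using ((hasDerivAt_id y).sub_const t).fun_pow (k + 2)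
      refine h1.congr_of_eventuallyEq ?_
      filter_upwards [Ioi_mem_nhds h] with z hz
      exact truncPow_of_ge (by omega) (le_of_lt hz)
  rcases eq_or_ne x t with rfl | hx
  · exact hasDerivAt_of_hasDerivAt_of_ne (g := fun y => (k + 2 : ℕ) * truncPow (k + 1) x y) hne
      (continuous_truncPow (k + 1) x).continuousAt
      (continuous_const.mul (continuous_truncPow k x)).continuousAt
  · exact hne x hx

theorem deriv_truncPow (k : ℕ) (t : ℝ) :
    deriv (truncPow (k + 2) t) = fun x => (k + 2 : ℕ) * truncPow (k + 1) t x :=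
  funext fun x => (hasDerivAt_truncPow k t x).deriv

theorem contDiff_truncPow (k : ℕ) (t : ℝ) : ContDiff ℝ k (truncPow (k + 1) t) := by
  induction k with
  | zero => simpa using continuous_truncPow 0 t
  | succ k ih =>
    have : ContDiff ℝ ((k : WithTop ℕ∞) + 1) (truncPow (k + 1 + 1) t) := by
      refine contDiff_succ_iff_deriv.2 ⟨fun x => (hasDerivAt_truncPow k t x).differentiableAt,
        by simp, ?_⟩
      rw [deriv_truncPow]
      exact contDiff_const.mul ih
    exact_mod_cast this

theorem iteratedDeriv_truncPow (q r : ℕ) (t : ℝ) :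
    iteratedDeriv q (truncPow (q + (r + 1)) t)
      = fun x => ((q + (r + 1)).descFactorial q : ℝ) * truncPow (r + 1) t x := by
  induction q with
  | zero => simp
  | succ q ih =>
    rw [iteratedDeriv_succ', show q + 1 + (r + 1) = (q + r) + 2 by ring, deriv_truncPow]
    ext x
    rw [iteratedDeriv_const_mul_field, show q + r + 1 = q + (r + 1) by ring, ih,
      Nat.succ_descFactorial_succ]
    push_cast
    ring_nf

/-- The spline `∑ μ_t (x - t)_+^k`. -/
noncomputable def splineOf (k : ℕ) (μ : ℝ →₀ ℝ) (x : ℝ) : ℝ :=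
  Finsupp.linearCombination ℝ (fun t => truncPow k t x) μ

/-- The polynomial `∑ μ_t (X - t)^k`. -/
noncomputable def polyOf (k : ℕ) (μ : ℝ →₀ ℝ) : ℝ[X] :=
  Finsupp.linearCombination ℝ (fun t => (X - C t) ^ k) μ

theorem splineOf_eq_sum (k : ℕ) (μ : ℝ →₀ ℝ) (x : ℝ) :
    splineOf k μ x = ∑ t ∈ μ.support, μ t * truncPow k t x := by
  simp [splineOf, Finsupp.linearCombination_apply, Finsupp.sum]

theorem polyOf_eq_sum (k : ℕ) (μ : ℝ →₀ ℝ) :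
    polyOf k μ = ∑ t ∈ μ.support, C (μ t) * (X - C t) ^ k := by
  simp [polyOf, Finsupp.linearCombination_apply, Finsupp.sum, smul_eq_C_mul]

theorem splineOf_add (k : ℕ) (μ ν : ℝ →₀ ℝ) (x : ℝ) :
    splineOf k (μ + ν) x = splineOf k μ x + splineOf k ν x := by simp [splineOf]

theorem splineOf_smul (k : ℕ) (a : ℝ) (μ : ℝ →₀ ℝ) (x : ℝ) :
    splineOf k (a • μ) x = a * splineOf k μ x := by simp [splineOf]

theorem polyOf_add (k : ℕ) (μ ν : ℝ →₀ ℝ) : polyOf k (μ + ν) = polyOf k μ + polyOf k ν := by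
  simp [polyOf]

theorem polyOf_smul (k : ℕ) (a : ℝ) (μ : ℝ →₀ ℝ) : polyOf k (a • μ) = C a * polyOf k μ := by
  simp [polyOf, smul_eq_C_mul]

theorem contDiff_splineOf (k : ℕ) (μ : ℝ →₀ ℝ) : ContDiff ℝ k (splineOf (k + 1) μ) := by
  rw [show splineOf (k + 1) μ = fun x => ∑ t ∈ μ.support, μ t * truncPow (k + 1) t x from
    funext fun x => splineOf_eq_sum _ _ _]
  exact ContDiff.sum fun t _ => contDiff_const.mul (contDiff_truncPow k t)

theorem iteratedDeriv_splineOf (q : ℕ) {r : ℕ} (hr : 1 ≤ r) (μ : ℝ →₀ ℝ) (x : ℝ) :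
    iteratedDeriv q (splineOf (q + r) μ) x = ((q + r).descFactorial q : ℝ) * splineOf r μ x := by
  obtain ⟨r, rfl⟩ : ∃ k, r = k + 1 := ⟨r - 1, by omega⟩
  rw [show splineOf (q + (r + 1)) μ = fun x => ∑ t ∈ μ.support, μ t * truncPow (q + (r + 1)) t x
    from funext fun x => splineOf_eq_sum _ _ _, iteratedDeriv_fun_sum, splineOf_eq_sum,
    Finset.mul_sum]
  · refine Finset.sum_congr rfl fun t _ => ?_
    rw [iteratedDeriv_const_mul_field, iteratedDeriv_truncPow]
    ring
  · intro t _
    exact (contDiff_const.mul ((contDiff_truncPow (q + r) t).of_le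
      (by exact_mod_cast Nat.le_add_right q r))).contDiffAt

theorem splineOf_of_le {k : ℕ} {μ : ℝ →₀ ℝ} {x : ℝ} (h : ∀ t ∈ μ.support, x ≤ t) :
    splineOf k μ x = 0 := by
  rw [splineOf_eq_sum]
  exact Finset.sum_eq_zero fun t ht => by rw [truncPow_of_le (h t ht), mul_zero]

theorem splineOf_of_ge {k : ℕ} (hk : k ≠ 0) {μ : ℝ →₀ ℝ} {x : ℝ} (h : ∀ t ∈ μ.support, t ≤ x) :
    splineOf k μ x = (polyOf k μ).eval x := by
  rw [splineOf_eq_sum, polyOf_eq_sum, eval_finsetSum]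
  exact Finset.sum_congr rfl fun t ht => by simp [truncPow_of_ge hk (h t ht)]

theorem splineOf_eq_polynomial (k : ℕ) {μ : ℝ →₀ ℝ} {a b : ℝ}
    (h : ∀ t ∈ μ.support, t ∉ Ioo a b) :
    ∃ Q : ℝ[X], Q.natDegree ≤ k ∧ ∀ x ∈ Ioo a b, splineOf k μ x = Q.eval x := by
  refine ⟨∑ t ∈ μ.support, if t ≤ a then C (μ t) * (X - C t) ^ k else 0, ?_, fun x hx => ?_⟩
  · refine natDegree_sum_le_of_forall_le _ _ fun t _ => ?_
    split_ifs
    · exact (natDegree_C_mul_le _ _).trans (by simp)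
    · simp
  · rw [splineOf_eq_sum, eval_finsetSum]
    refine Finset.sum_congr rfl fun t ht => ?_
    split_ifs with h1
    · simp [truncPow, h1.trans_lt hx.1]
    · have : b ≤ t := by
        by_contra h2
        exact h t ht ⟨not_le.1 h1, not_le.1 h2⟩
      rw [truncPow_of_le (hx.2.le.trans this)]
      simp

theorem iterate_derivative_polyOf (q r : ℕ) (μ : ℝ →₀ ℝ) :
    derivative^[q] (polyOf (q + r) μ) = C ((q + r).descFactorial q : ℝ) * polyOf r μ := by
  rw [polyOf_eq_sum, polyOf_eq_sum, iterate_derivative_sum, Finset.mul_sum]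
  refine Finset.sum_congr rfl fun t _ => ?_
  rw [iterate_derivative_C_mul, iterate_derivative_X_sub_pow, Nat.add_sub_cancel_left,
    nsmul_eq_mul]
  simp only [map_natCast]
  ring

/-! ### Estimates through polynomial coefficients. -/

/-- The sum of the absolute values of the coefficients of `P` up to degree `n`. -/
noncomputable def coeffNorm (n : ℕ) (P : ℝ[X]) : ℝ := ∑ i ∈ Finset.range (n + 1), |P.coeff i|

theorem coeffNorm_nonneg (n : ℕ) (P : ℝ[X]) : 0 ≤ coeffNorm n P :=
  Finset.sum_nonneg fun _ _ => abs_nonneg _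

theorem coeffNorm_add_le (n : ℕ) (P Q : ℝ[X]) :
    coeffNorm n (P + Q) ≤ coeffNorm n P + coeffNorm n Q := by
  unfold coeffNorm
  rw [← Finset.sum_add_distrib]
  exact Finset.sum_le_sum fun i _ => by rw [coeff_add]; exact abs_add_le _ _

theorem coeffNorm_C_mul (n : ℕ) (a : ℝ) (P : ℝ[X]) :
    coeffNorm n (C a * P) = |a| * coeffNorm n P := by
  simp [coeffNorm, Finset.mul_sum, abs_mul]

theorem coeffNorm_sum_le {ι : Type*} (n : ℕ) (s : Finset ι) (P : ι → ℝ[X]) :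
    coeffNorm n (∑ i ∈ s, P i) ≤ ∑ i ∈ s, coeffNorm n (P i) := by
  classical
  induction s using Finset.induction_on with
  | empty => simp [coeffNorm]
  | insert i s hi ih =>
    rw [Finset.sum_insert hi, Finset.sum_insert hi]
    exact (coeffNorm_add_le _ _ _).trans (by linarith)

theorem abs_eval_le_coeffNorm {n : ℕ} {P : ℝ[X]} (hP : P.natDegree ≤ n) {x : ℝ} (hx : |x| ≤ 1) :
    |P.eval x| ≤ coeffNorm n P := by
  rw [eval_eq_sum_range' (Nat.lt_succ_of_le hP)]
  refine (Finset.abs_sum_le_sum_abs _ _).trans (Finset.sum_le_sum fun i _ => ?_)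
  rw [abs_mul, abs_pow]
  exact mul_le_of_le_one_right (abs_nonneg _) (pow_le_one₀ (abs_nonneg _) hx)

theorem abs_eval_sub_eval_le {n : ℕ} {P : ℝ[X]} (hP : P.natDegree ≤ n) {x y : ℝ} (hx : |x| ≤ 1)
    (hy : |y| ≤ 1) : |P.eval x - P.eval y| ≤ coeffNorm n P * (n * |x - y|) := by
  have hpow : ∀ i : ℕ, |x ^ i - y ^ i| ≤ i * |x - y| := by
    intro i
    induction i with
    | zero => simp
    | succ i ih =>
      have h1 : x ^ (i + 1) - y ^ (i + 1) = x * (x ^ i - y ^ i) + (x - y) * y ^ i := by ring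
      rw [h1]
      refine (abs_add_le _ _).trans ?_
      rw [abs_mul, abs_mul, abs_pow]
      have h2 : |x| * |x ^ i - y ^ i| ≤ i * |x - y| :=
        (mul_le_of_le_one_left (abs_nonneg _) hx).trans ih
      have h3 : |x - y| * |y| ^ i ≤ |x - y| :=
        mul_le_of_le_one_right (abs_nonneg _) (pow_le_one₀ (abs_nonneg _) hy)
      push_cast
      linarith
  rw [eval_eq_sum_range' (Nat.lt_succ_of_le hP), eval_eq_sum_range' (Nat.lt_succ_of_le hP),
    ← Finset.sum_sub_distrib, coeffNorm, Finset.sum_mul]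
  refine (Finset.abs_sum_le_sum_abs _ _).trans (Finset.sum_le_sum fun i hi => ?_)
  rw [← mul_sub, abs_mul]
  refine mul_le_mul_of_nonneg_left ((hpow i).trans ?_) (abs_nonneg _)
  refine mul_le_mul_of_nonneg_right ?_ (abs_nonneg _)
  exact_mod_cast Nat.lt_succ_iff.1 (Finset.mem_range.1 hi)

/-- On any fixed subinterval of `[-1, 1]`, a polynomial is comparable with its coefficients on
some interval of fixed length. -/
theorem exists_Icc_coeffNorm_le (n : ℕ) {a b : ℝ} (ha : -1 ≤ a) (hab : a < b) (hb : b ≤ 1) :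
    ∃ c ρ : ℝ, 0 < c ∧ 0 < ρ ∧ ∀ P : ℝ[X], P.natDegree ≤ n →
      ∃ u, a ≤ u ∧ u + ρ ≤ b ∧ ∀ x ∈ Icc u (u + ρ), c * coeffNorm n P ≤ |P.eval x| := by
  set l : ℝ := (b - a) / (n + 1) with hl
  have hl0 : 0 < l := by have : 0 < b - a := by linarith
                         positivity
  let v : ℕ → ℝ := fun i => a + i * l
  have hinj : Set.InjOn v (Finset.range (n + 1)) := by
    intro i _ j _ hij
    have : (i : ℝ) * l = j * l := by simpa [v] using hij
    exact_mod_cast mul_right_cancel₀ hl0.ne' this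
  set S : ℝ := ∑ i ∈ Finset.range (n + 1), coeffNorm n (Lagrange.basis (Finset.range (n + 1)) v i)
    with hS
  have hS0 : 0 ≤ S := Finset.sum_nonneg fun _ _ => coeffNorm_nonneg _ _
  -- If `P` were small at all `n + 1` nodes, Lagrange interpolation would make its coefficients too
  -- small.
  have key : ∀ P : ℝ[X], P.natDegree ≤ n →
      ∃ i ∈ Finset.range (n + 1), coeffNorm n P ≤ (S + 1) * |P.eval (v i)| := by
    intro P hP
    by_contra! hcon
    have h1 : P = Lagrange.interpolate (Finset.range (n + 1)) v fun i => P.eval (v i) :=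
      Lagrange.eq_interpolate hinj
        (degree_le_natDegree.trans_lt (by rw [Finset.card_range]; norm_cast; omega))
    have h2 : coeffNorm n P ≤ ∑ i ∈ Finset.range (n + 1), |P.eval (v i)| *
        coeffNorm n (Lagrange.basis (Finset.range (n + 1)) v i) := by
      nth_rewrite 1 [h1]
      rw [Lagrange.interpolate_apply]
      refine (coeffNorm_sum_le _ _ _).trans (Finset.sum_le_sum fun i _ => ?_)
      rw [coeffNorm_C_mul]
    have h0 : 0 < coeffNorm n P := lt_of_le_of_lt (by positivity) (hcon 0 (by simp))
    have h3 : coeffNorm n P * (S + 1) ≤ coeffNorm n P * S := by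
      refine (mul_le_mul_of_nonneg_right h2 (by linarith)).trans ?_
      rw [hS, Finset.sum_mul, Finset.mul_sum, ← hS]
      refine Finset.sum_le_sum fun i hi => ?_
      have := (hcon i hi).le
      have h4 := coeffNorm_nonneg n (Lagrange.basis (Finset.range (n + 1)) v i)
      nlinarith
    nlinarith
  -- By the Lipschitz bound, over a length `ρ` the polynomial loses at most half of the lower bound
  -- for its value at the node.
  set ρ : ℝ := min l (1 / (2 * (S + 1) * (n + 1))) with hρ
  have hρ0 : 0 < ρ := lt_min hl0 (by positivity)
  refine ⟨1 / (2 * (S + 1)), ρ, by positivity, hρ0, fun P hP => ?_⟩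
  obtain ⟨i, hi, h⟩ := key P hP
  have hin : (i : ℝ) + 1 ≤ n + 1 := by
    have : i + 1 ≤ n + 1 := Finset.mem_range.1 hi
    exact_mod_cast this
  have hvl : v i + l ≤ b := by
    have h1 : (n + 1) * l = b - a := by rw [hl]; field_simp
    have : v i + l = a + (i + 1) * l := by simp only [v]; ring
    rw [this]
    nlinarith
  have hav : a ≤ v i := by simp only [v]; nlinarith [hl0, (Nat.cast_nonneg i : (0 : ℝ) ≤ i)]
  refine ⟨v i, hav, by linarith [min_le_left l (1 / (2 * (S + 1) * (n + 1)))], fun x hx => ?_⟩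
  have hρl : ρ ≤ l := min_le_left _ _
  have hρr : ρ ≤ 1 / (2 * (S + 1) * (n + 1)) := min_le_right _ _
  have h1 := abs_eval_sub_eval_le hP (x := v i) (y := x)
    (abs_le.2 ⟨by linarith, by linarith⟩) (abs_le.2 ⟨by linarith [hx.1], by linarith [hx.2]⟩)
  have h2 : n * |v i - x| ≤ 1 / (2 * (S + 1)) := by
    have : |v i - x| ≤ ρ := by
      rw [abs_sub_comm, abs_of_nonneg (by linarith [hx.1])]; linarith [hx.2]
    calc n * |v i - x| ≤ (n + 1) * (1 / (2 * (S + 1) * (n + 1))) := by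
          refine mul_le_mul (by linarith) (this.trans hρr) (abs_nonneg _) (by positivity)
      _ = 1 / (2 * (S + 1)) := by field_simp
  have h3 : coeffNorm n P * (n * |v i - x|) ≤ coeffNorm n P * (1 / (2 * (S + 1))) :=
    mul_le_mul_of_nonneg_left h2 (coeffNorm_nonneg _ _)
  have h4 : 1 / (S + 1) * coeffNorm n P ≤ |P.eval (v i)| := by
    rw [one_div, inv_mul_le_iff₀ (by positivity)]; exact h
  have h5 : |P.eval (v i)| - |P.eval x| ≤ |P.eval (v i) - P.eval x| := abs_sub_abs_le_abs_sub _ _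
  have h6 : 1 / (S + 1) = 2 * (1 / (2 * (S + 1))) := by field_simp
  rw [h6] at h4
  linarith

theorem abs_coeff_prod_X_sub_C_le {ι : Type*} (s : Finset ι) (v : ι → ℝ) {R : ℝ}
    (hv : ∀ i ∈ s, |v i| ≤ R) (hR : 0 ≤ R) (k : ℕ) :
    |(∏ i ∈ s, (X - C (v i))).coeff k| * R ^ k ≤ (2 * R) ^ s.card := by
  classical
  induction s using Finset.induction_on generalizing k with
  | empty =>
    rcases k with _ | k
    · simp
    · simp [coeff_one]
  | insert i s hi ih =>
    have ih' := ih fun j hj => hv j (Finset.mem_insert_of_mem hj)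
    rw [Finset.prod_insert hi, Finset.card_insert_of_notMem hi, sub_mul, coeff_sub, coeff_C_mul]
    have hvi := hv i (Finset.mem_insert_self i s)
    set p := ∏ i ∈ s, (X - C (v i))
    have h1 : |(X * p).coeff k| * R ^ k ≤ R * (2 * R) ^ s.card := by
      rcases k with _ | k
      · simp; positivity
      · rw [coeff_X_mul, pow_succ]
        nlinarith [ih' k]
    have h2 : |v i * p.coeff k| * R ^ k ≤ R * (2 * R) ^ s.card := by
      rw [abs_mul, mul_assoc]
      exact mul_le_mul hvi (ih' k) (by positivity) hR
    calc _ ≤ (|(X * p).coeff k| + |v i * p.coeff k|) * R ^ k :=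
          mul_le_mul_of_nonneg_right (abs_sub _ _) (by positivity)
      _ ≤ (2 * R) ^ (s.card + 1) := by rw [pow_succ]; linarith

/-- The weight `R ^ k` records that, for nodes within `R` of 0 at mutual distances comparable to
`R`, the `k`-th coefficient costs only `R^(-k)`. This is what later yields `R^(-r)` in place of
`R^(-(q+r))`. -/
theorem abs_coeff_basis_le {s : Finset ℝ} {n : ℕ} (hs : s.card = n + 1) {R σ : ℝ} (hσ : 0 < σ)
    (hR : ∀ t ∈ s, |t| ≤ R) (hsep : ∀ t ∈ s, ∀ t' ∈ s, t ≠ t' → σ ≤ |t - t'|) {x : ℝ} (hx : x ∈ s)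
    (k : ℕ) : |(Lagrange.basis s id x).coeff k| * R ^ k ≤ (2 * R / σ) ^ n := by
  have hR0 : 0 ≤ R := (abs_nonneg _).trans (hR x hx)
  have hcard : (s.erase x).card = n := by rw [Finset.card_erase_of_mem hx]; omega
  have h1 : Lagrange.basis s id x
      = C (∏ y ∈ s.erase x, (x - y)⁻¹) * ∏ y ∈ s.erase x, (X - C (id y)) := by
    simp only [Lagrange.basis, Lagrange.basisDivisor, Finset.prod_mul_distrib, map_prod, id]
  have h2 := abs_coeff_prod_X_sub_C_le (s.erase x) id
    (fun i hi => hR i (Finset.mem_of_mem_erase hi)) hR0 k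
  have h3 : |∏ y ∈ s.erase x, (x - y)⁻¹| ≤ (σ⁻¹) ^ n := by
    rw [Finset.abs_prod, ← hcard]
    rw [← Finset.prod_const]
    refine Finset.prod_le_prod (fun _ _ => abs_nonneg _) fun y hy => ?_
    rw [abs_inv]
    exact inv_anti₀ hσ (hsep x hx y (Finset.mem_of_mem_erase hy) (Finset.ne_of_mem_erase hy).symm)
  rw [hcard] at h2
  rw [h1, coeff_C_mul, abs_mul, mul_assoc, div_eq_mul_inv, mul_pow, mul_comm ((2 * R) ^ n)]
  exact mul_le_mul h3 h2 (by positivity) (by positivity)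

theorem abs_eval_iterate_derivative_le {P : ℝ[X]} {n : ℕ} (hP : P.natDegree ≤ n) (k : ℕ) {x : ℝ}
    (hx : |x| ≤ 1) {B : ℝ} (hB : ∀ i, |P.coeff i| ≤ B) :
    |(derivative^[k] P).eval x| ≤ (n + 1) * ((n + k) ^ k * B) := by
  have hB0 : 0 ≤ B := (abs_nonneg _).trans (hB 0)
  refine (abs_eval_le_coeffNorm (n := n)
    ((natDegree_iterate_derivative P k).trans (by omega)) hx).trans ?_
  unfold coeffNorm
  refine (Finset.sum_le_card_nsmul _ _ ((n + k) ^ k * B) fun i hi => ?_).trans (by simp)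
  rw [coeff_iterate_derivative, nsmul_eq_mul, abs_mul, Nat.abs_cast]
  refine mul_le_mul ?_ (hB _) (abs_nonneg _) (by positivity)
  have h1 := Nat.descFactorial_le_pow (i + k) k
  have h2 : (i + k) ^ k ≤ (n + k) ^ k :=
    Nat.pow_le_pow_left (by have := Finset.mem_range.1 hi; omega) k
  exact_mod_cast h1.trans h2

/-- Differentiation only shifts the surviving coefficients and multiplies them by positive integers.
-/
theorem coeffNorm_le_coeffNorm_iterate_derivative {q r : ℕ} {D : ℝ[X]}
    (hD : ∀ i < q, D.coeff i = 0) :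
    coeffNorm (q + r) D ≤ coeffNorm r (derivative^[q] D) := by
  unfold coeffNorm
  rw [add_assoc, Finset.sum_range_add, Finset.sum_eq_zero fun i hi => by
    rw [hD i (Finset.mem_range.1 hi), abs_zero], zero_add]
  refine Finset.sum_le_sum fun i _ => ?_
  rw [coeff_iterate_derivative, nsmul_eq_mul, abs_mul, Nat.abs_cast, add_comm q i]
  refine le_mul_of_one_le_left (abs_nonneg _) ?_
  exact_mod_cast Nat.succ_le_of_lt (Nat.descFactorial_pos.2 (by omega))

/-! ### Discrete measures on dense meshes. -/

/-- Every closed subinterval of `[-1, 1]` of length `σ` meets `K`. -/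
def IsMeshDense (K : Set ℝ) (σ : ℝ) : Prop :=
  ∀ u, -1 ≤ u → u + σ ≤ 1 → ∃ t ∈ K, t ∈ Icc u (u + σ)

theorem IsMeshDense.mono {K : Set ℝ} {σ σ' : ℝ} (h : IsMeshDense K σ) (hσ : σ ≤ σ') :
    IsMeshDense K σ' := fun u hu hu' => by
  obtain ⟨t, ht, h1, h2⟩ := h u hu (by linarith)
  exact ⟨t, ht, h1, by linarith⟩

/-- Pick one mesh point in every other interval of length `σ`; the skipped intervals provide the
separation. -/
theorem IsMeshDense.exists_separated {K : Set ℝ} {σ : ℝ} (h : IsMeshDense K σ) (hσ : 0 < σ)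
    (N : ℕ) {u : ℝ} (hu : -1 ≤ u) (hu' : u + 2 * N * σ ≤ 1) :
    ∃ s : Finset ℝ, s.card = N ∧ (∀ t ∈ s, t ∈ K ∧ t ∈ Icc u (u + 2 * N * σ)) ∧
      ∀ t ∈ s, ∀ t' ∈ s, t ≠ t' → σ ≤ |t - t'| := by
  have hN : ∀ i : Fin N, (i : ℝ) + 1 ≤ N := fun i => by exact_mod_cast i.2
  have hi0 : ∀ i : Fin N, (0 : ℝ) ≤ i := fun i => Nat.cast_nonneg _
  have hex : ∀ i : Fin N, ∃ t ∈ K, t ∈ Icc (u + 2 * i * σ) (u + 2 * i * σ + σ) := fun i =>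
    h _ (by nlinarith [hi0 i]) (by nlinarith [hN i])
  choose t htK ht using hex
  have hlt : ∀ i j : Fin N, i < j → t i + σ ≤ t j := by
    intro i j hij
    have : (i : ℝ) + 1 ≤ j := by exact_mod_cast hij
    nlinarith [(ht i).2, (ht j).1]
  have hinj : Function.Injective t := by
    intro i j hij
    rcases lt_trichotomy i j with h1 | h1 | h1
    · linarith [hlt i j h1]
    · exact h1
    · linarith [hlt j i h1]
  refine ⟨Finset.univ.map ⟨t, hinj⟩, by simp, ?_, ?_⟩
  · intro x hx
    obtain ⟨i, -, rfl⟩ := Finset.mem_map.1 hx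
    refine ⟨htK i, ?_, ?_⟩
    · have := (ht i).1
      simp only [Function.Embedding.coeFn_mk]
      nlinarith [hi0 i]
    · have := (ht i).2
      simp only [Function.Embedding.coeFn_mk]
      nlinarith [hN i]
  · intro x hx y hy hxy
    obtain ⟨i, -, rfl⟩ := Finset.mem_map.1 hx
    obtain ⟨j, -, rfl⟩ := Finset.mem_map.1 hy
    simp only [Function.Embedding.coeFn_mk] at hxy ⊢
    rcases lt_trichotomy i j with h1 | h1 | h1
    · rw [abs_sub_comm]
      exact (by linarith [hlt i j h1] : σ ≤ t j - t i).trans (le_abs_self _)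
    · exact absurd (congrArg t h1) hxy
    · exact (by linarith [hlt j i h1] : σ ≤ t i - t j).trans (le_abs_self _)

/-- The discrete measure with mass `w x` at each `x ∈ s`. -/
noncomputable def discreteMeasure (s : Finset ℝ) (w : ℝ → ℝ) : ℝ →₀ ℝ :=
  ∑ x ∈ s, Finsupp.single x (w x)

theorem support_discreteMeasure (s : Finset ℝ) (w : ℝ → ℝ) :
    (discreteMeasure s w).support ⊆ s := by
  refine Finsupp.support_finsetSum.trans ?_
  refine Finset.biUnion_subset.2 fun x hx => ?_
  exact Finsupp.support_single_subset.trans (Finset.singleton_subset_iff.2 hx)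

theorem linearCombination_discreteMeasure {M : Type*} [AddCommGroup M] [Module ℝ M] (s : Finset ℝ)
    (w : ℝ → ℝ) (φ : ℝ → M) :
    Finsupp.linearCombination ℝ φ (discreteMeasure s w) = ∑ x ∈ s, w x • φ x := by
  simp [discreteMeasure]

theorem abs_linearCombination_discreteMeasure_le {s : Finset ℝ} {w φ : ℝ → ℝ} {A B : ℝ}
    (hw : ∀ x ∈ s, |w x| ≤ A) (hφ : ∀ x ∈ s, |φ x| ≤ B) :
    |Finsupp.linearCombination ℝ φ (discreteMeasure s w)| ≤ s.card * (A * B) := by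
  rw [linearCombination_discreteMeasure]
  refine (Finset.abs_sum_le_sum_abs _ _).trans ?_
  refine (Finset.sum_le_card_nsmul _ _ (A * B) fun x hx => ?_).trans (by simp)
  rw [smul_eq_mul, abs_mul]
  exact mul_le_mul (hw x hx) (hφ x hx) (abs_nonneg _) ((abs_nonneg _).trans (hw x hx))

theorem sum_eval_mul_basis {s : Finset ℝ} {P : ℝ[X]} (hP : P.degree < s.card) :
    ∑ x ∈ s, C (P.eval x) * Lagrange.basis s id x = P := by
  have h := Lagrange.eq_interpolate (s := s) (v := id) Function.injective_id.injOn hP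
  rw [Lagrange.interpolate_apply] at h
  exact h.symm

/-- A polynomial jump is realized by a discrete measure on knots of a short interval. -/
theorem exists_polyOf_eq (q r : ℕ) : ∃ A : ℝ, 0 < A ∧ ∀ (K : Set ℝ) (R : ℝ), 0 < R → R ≤ 1 →
    IsMeshDense K (R / (2 * (q + r + 1))) → ∀ D : ℝ[X], D.natDegree ≤ q + r →
    (∀ i < q, D.coeff i = 0) →
    ∃ μ : ℝ →₀ ℝ, (∀ t ∈ μ.support, t ∈ K ∧ t ∈ Icc 0 R) ∧ polyOf (q + r) μ = D ∧
      ∀ (φ : ℝ → ℝ) (B : ℝ), (∀ t ∈ Icc 0 R, |φ t| ≤ B) →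
        |Finsupp.linearCombination ℝ φ μ| * R ^ r ≤ A * coeffNorm (q + r) D * B := by
  set d := q + r with hd
  refine ⟨(d + 1) * (4 * (d + 1)) ^ d, by positivity, fun K R hR hR1 hK D hD hD0 => ?_⟩
  have hdc : (q : ℝ) + r + 1 = d + 1 := by rw [hd]; push_cast; ring
  rw [hdc] at hK
  set σ : ℝ := R / (2 * (d + 1)) with hσ
  have hσ0 : 0 < σ := by positivity
  have hlen : (0 : ℝ) + 2 * ((d + 1 : ℕ) : ℝ) * σ = R := by rw [hσ]; push_cast; field_simp; ring
  obtain ⟨s, hcard, hsK, hsep⟩ := hK.exists_separated hσ0 (d + 1) (u := 0) (by norm_num)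
    (by rw [hlen]; exact hR1)
  rw [hlen] at hsK
  have hsR : ∀ t ∈ s, |t| ≤ R := fun t ht => by
    rw [abs_of_nonneg (hsK t ht).2.1]; exact (hsK t ht).2.2
  -- Matching the coefficients of `∑ w_x (X - x)^d` with `D` prescribes the moments of `w`. The
  -- functionals `x ↦ coeff_k` of the Lagrange basis are dual to the monomials on `s`, so this
  -- combination has exactly those moments.
  let w : ℝ → ℝ := fun x => ∑ i ∈ Finset.range (d + 1),
    D.coeff i * ((-1) ^ (d - i) / (d.choose i : ℝ)) * (Lagrange.basis s id x).coeff (d - i)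
  have hw : ∀ x ∈ s, |w x| * R ^ r ≤ (4 * (d + 1)) ^ d * coeffNorm d D := by
    intro x hx
    have h1 : |w x| ≤ ∑ i ∈ Finset.range (d + 1),
        |D.coeff i| * |(Lagrange.basis s id x).coeff (d - i)| := by
      refine (Finset.abs_sum_le_sum_abs _ _).trans (Finset.sum_le_sum fun i hi => ?_)
      rw [abs_mul, abs_mul]
      refine mul_le_mul_of_nonneg_right (mul_le_of_le_one_right (abs_nonneg _) ?_) (abs_nonneg _)
      rw [abs_div, abs_pow, abs_neg, abs_one, one_pow, Nat.abs_cast]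
      have : 1 ≤ d.choose i := Nat.choose_pos (by have := Finset.mem_range.1 hi; omega)
      exact div_le_one_of_le₀ (by exact_mod_cast this) (by positivity)
    refine (mul_le_mul_of_nonneg_right h1 (by positivity)).trans ?_
    rw [Finset.sum_mul, coeffNorm, Finset.mul_sum]
    refine Finset.sum_le_sum fun i hi => ?_
    rcases lt_or_ge i q with hiq | hiq
    · simp [hD0 i hiq]
    -- Only `i ≥ q` contributes, so `d - i ≤ r` and the power of `1/R` never exceeds `r`.
    · have h2 := abs_coeff_basis_le hcard hσ0 hsR hsep hx (d - i)
      have h3 : 2 * R / σ = 4 * (d + 1) := by rw [hσ]; field_simp; ring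
      rw [h3] at h2
      have h4 : R ^ r ≤ R ^ (d - i) := pow_le_pow_of_le_one hR.le hR1 (by omega)
      rw [mul_assoc, mul_comm _ |D.coeff i|]
      refine mul_le_mul_of_nonneg_left (le_trans ?_ h2) (abs_nonneg _)
      exact mul_le_mul_of_nonneg_left h4 (abs_nonneg _)
  refine ⟨discreteMeasure s w, fun t ht => hsK t (support_discreteMeasure s w ht), ?_, ?_⟩
  · have hmom : ∀ i ≤ d, ∑ x ∈ s, w x * x ^ (d - i)
        = D.coeff i * ((-1) ^ (d - i) / (d.choose i : ℝ)) := by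
      intro i hi
      have h1 := sum_eval_mul_basis (s := s) (P := X ^ (d - i))
        (by rw [degree_X_pow, hcard]; norm_cast; omega)
      have h2 : ∀ j ≤ d, ∑ x ∈ s, x ^ (d - i) * (Lagrange.basis s id x).coeff (d - j)
          = if j = i then 1 else 0 := by
        intro j hj
        have := congrArg (fun P => P.coeff (d - j)) h1
        simp only [finsetSum_coeff, coeff_C_mul, coeff_X_pow, eval_pow, eval_X] at this
        rw [this]
        congr 1
        exact propext ⟨by omega, by omega⟩
      calc ∑ x ∈ s, w x * x ^ (d - i)
          = ∑ j ∈ Finset.range (d + 1), D.coeff j * ((-1) ^ (d - j) / (d.choose j : ℝ)) *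
              ∑ x ∈ s, x ^ (d - i) * (Lagrange.basis s id x).coeff (d - j) := by
            simp only [w, Finset.sum_mul, Finset.mul_sum]
            rw [Finset.sum_comm]
            exact Finset.sum_congr rfl fun _ _ => Finset.sum_congr rfl fun _ _ => by ring
        _ = ∑ j ∈ Finset.range (d + 1), D.coeff j * ((-1) ^ (d - j) / (d.choose j : ℝ)) *
              (if j = i then 1 else 0) :=
            Finset.sum_congr rfl fun j hj => by
              rw [h2 j (by have := Finset.mem_range.1 hj; omega)]
        _ = _ := by
            simp only [mul_ite, mul_one, mul_zero]
            rw [Finset.sum_ite_eq' (Finset.range (d + 1)) i, if_pos (by simp; omega)]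
    rw [polyOf, linearCombination_discreteMeasure]
    ext i
    rw [finsetSum_coeff]
    simp only [coeff_smul, smul_eq_mul, sub_eq_add_neg X, ← C_neg, coeff_X_add_C_pow]
    rcases le_or_gt i d with hi | hi
    · have h1 : ∀ x ∈ s, w x * ((-x) ^ (d - i) * (d.choose i : ℝ))
          = (w x * x ^ (d - i)) * ((-1) ^ (d - i) * (d.choose i : ℝ)) := by
        intro x _
        rw [neg_pow]; ring
      have h2 : (d.choose i : ℝ) ≠ 0 := by exact_mod_cast (Nat.choose_pos hi).ne'
      rw [Finset.sum_congr rfl h1, ← Finset.sum_mul, hmom i hi]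
      have h3 : ((-1 : ℝ) ^ (d - i)) * (-1) ^ (d - i) = 1 := by
        rw [← mul_pow]; norm_num
      field_simp
      linear_combination D.coeff i * h3
    · rw [coeff_eq_zero_of_natDegree_lt (by omega)]
      exact Finset.sum_eq_zero fun x _ => by rw [Nat.choose_eq_zero_of_lt hi]; simp
  · intro φ B hφ
    have hRr : 0 < R ^ r := by positivity
    have h1 := abs_linearCombination_discreteMeasure_le (s := s) (w := w) (φ := φ)
      (fun x hx => (le_div_iff₀ hRr).2 (hw x hx)) (fun x hx => hφ x (hsK x hx).2)
    calc _ ≤ s.card * ((4 * (d + 1)) ^ d * coeffNorm d D / R ^ r * B) * R ^ r :=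
          mul_le_mul_of_nonneg_right h1 hRr.le
      _ = _ := by rw [hcard]; push_cast; field_simp

/-! ### The compactly supported correction. -/

/-- Knots of a B-spline which is supported near the origin and large on `[0, R]`. -/
theorem exists_bspline (r : ℕ) {K : Set ℝ} {R : ℝ} (hR : 0 < R) (hR1 : (2 * r + 4) * R ≤ 1)
    (hK : IsMeshDense K R) :
    ∃ T : Finset ℝ, T.card = r + 2 ∧
      (∀ t ∈ T, t ∈ K ∧ t ∈ Icc (-2 * R) ((2 * r + 4) * R)) ∧
      (∀ t ∈ T, |1 / ∏ y ∈ T.erase t, (t - y)| ≤ 1 / R ^ (r + 1)) ∧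
      ∀ x ∈ Icc 0 R, 1 / ((2 * r + 6) ^ (r + 1) * R) ≤ divDiff T (upperPow r x) := by
  have hrR : 0 ≤ r * R := by positivity
  -- One knot lies in `[-2R, -R]` and all the others lie in `[2R, (2r+4)R]`. Then `[0, R]` is inside
  -- the first knot interval, where the B-spline is an explicit monomial over a product.
  obtain ⟨a, haK, ha⟩ := hK (-2 * R) (by nlinarith) (by nlinarith)
  have hlen : 2 * R + 2 * ((r + 1 : ℕ) : ℝ) * R = (2 * r + 4) * R := by push_cast; ring
  obtain ⟨s, hcard, hsK, hsep⟩ := hK.exists_separated hR (r + 1) (u := 2 * R) (by linarith)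
    (by rw [hlen]; exact hR1)
  rw [hlen] at hsK
  have ha1 := ha.1
  have ha2 := ha.2
  have has : a ∉ s := fun h => by have := (hsK a h).2.1; linarith
  have hcardT : (insert a s).card = r + 2 := by rw [Finset.card_insert_of_notMem has, hcard]
  have hsepT : ∀ t ∈ insert a s, ∀ y ∈ insert a s, t ≠ y → R ≤ |t - y| := by
    intro t ht y hy hty
    rcases Finset.mem_insert.1 ht with hta | hts <;> rcases Finset.mem_insert.1 hy with hya | hys
    · exact absurd (hta.trans hya.symm) hty
    · rw [abs_sub_comm]
      exact le_trans (by linarith [(hsK y hys).2.1]) (le_abs_self _)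
    · exact le_trans (by linarith [(hsK t hts).2.1]) (le_abs_self _)
    · exact hsep t hts y hys hty
  refine ⟨insert a s, hcardT, ?_, ?_, ?_⟩
  · intro t ht
    rcases Finset.mem_insert.1 ht with rfl | ht
    · exact ⟨haK, ha1, by nlinarith⟩
    · exact ⟨(hsK t ht).1, by linarith [(hsK t ht).2.1], (hsK t ht).2.2⟩
  · intro t ht
    rw [abs_div, abs_one, Finset.abs_prod]
    refine one_div_le_one_div_of_le (by positivity) ?_
    have hc : ((insert a s).erase t).card = r + 1 := by
      rw [Finset.card_erase_of_mem ht, hcardT]; omega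
    rw [← hc, ← Finset.prod_const]
    exact Finset.prod_le_prod (fun _ _ => hR.le) fun y hy =>
      hsepT t ht y (Finset.mem_of_mem_erase hy) (Finset.ne_of_mem_erase hy).symm
  · intro x hx
    have hera : (insert a s).erase a = s := Finset.erase_insert has
    rw [divDiff_upperPow_first (Finset.mem_insert_self a s) hcardT (by linarith [hx.1])
      (by rw [hera]; intro t ht; linarith [hx.2, (hsK t ht).2.1]), hera]
    have h1 : ∏ t ∈ s, (t - a) ≤ ((2 * r + 6) * R) ^ (r + 1) := by
      rw [← hcard, ← Finset.prod_const]
      refine Finset.prod_le_prod (fun t ht => ?_) fun t ht => ?_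
      · linarith [(hsK t ht).2.1]
      · nlinarith [(hsK t ht).2.2]
    have h0 : 0 < ∏ t ∈ s, (t - a) := Finset.prod_pos fun t ht => by linarith [(hsK t ht).2.1]
    have h2 : R ^ r ≤ (x - a) ^ r := pow_le_pow_left₀ hR.le (by linarith [hx.1]) r
    rw [div_le_div_iff₀ (by positivity) h0, one_mul]
    calc ∏ t ∈ s, (t - a) ≤ ((2 * r + 6) * R) ^ (r + 1) := h1
      _ = R ^ r * ((2 * r + 6) ^ (r + 1) * R) := by rw [mul_pow, pow_succ R]; ring
      _ ≤ _ := mul_le_mul_of_nonneg_right h2 (by positivity)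

/-- A divided difference is represented on polynomials by a discrete measure on knots of a
given interval. -/
theorem exists_measure_eq_divDiff (d r : ℕ) {ρ : ℝ} (hρ : 0 < ρ) : ∃ A : ℝ, 0 < A ∧
    ∀ (K : Set ℝ) (u : ℝ), -1 ≤ u → u + ρ ≤ 1 → IsMeshDense K (ρ / (2 * (d + 1))) →
    ∀ T : Finset ℝ, T.card = r + 2 → (∀ t ∈ T, t ∈ Icc (-1 : ℝ) 1) →
    ∃ ν : ℝ →₀ ℝ, (∀ t ∈ ν.support, t ∈ K ∧ t ∈ Icc u (u + ρ)) ∧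
      (∀ P : ℝ[X], P.natDegree ≤ d →
        Finsupp.linearCombination ℝ (fun t => P.eval t) ν = divDiff T fun t => P.eval t) ∧
      ∀ (φ : ℝ → ℝ) (B : ℝ), (∀ t ∈ Icc u (u + ρ), |φ t| ≤ B) →
        |Finsupp.linearCombination ℝ φ ν| ≤ A * B := by
  set σ : ℝ := ρ / (2 * (d + 1)) with hσ
  have hσ0 : 0 < σ := by positivity
  set A : ℝ := (d + 1) * ((d + (r + 1 : ℕ)) ^ (r + 1) * (2 * 1 / σ) ^ d) with hA
  refine ⟨(d + 1) * A, by positivity, fun K u hu hu' hK T hT hT1 => ?_⟩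
  have hlen : u + 2 * ((d + 1 : ℕ) : ℝ) * σ = u + ρ := by rw [hσ]; push_cast; field_simp
  obtain ⟨s, hcard, hsK, hsep⟩ := hK.exists_separated hσ0 (d + 1) hu (by rw [hlen]; exact hu')
  rw [hlen] at hsK
  have hs1 : ∀ t ∈ s, |t| ≤ 1 := fun t ht =>
    abs_le.2 ⟨hu.trans (hsK t ht).2.1, (hsK t ht).2.2.trans hu'⟩
  -- Apply the divided difference to the interpolant on `s`. By the mean value theorem the weights
  -- are bounded by derivatives of the basis polynomials, whatever the spacing of `T`; hence `A`
  -- does not degrade when the points of `T` cluster.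
  let w : ℝ → ℝ := fun x => divDiff T fun t => (Lagrange.basis s id x).eval t
  have hw : ∀ x ∈ s, |w x| ≤ A := by
    intro x hx
    obtain ⟨ξ, hξ, h⟩ := divDiff_eq_iteratedDeriv (n := r + 1) hT hT1
      (contDiff_polynomial_eval (Lagrange.basis s id x) _)
    have hdeg : (Lagrange.basis s id x).natDegree ≤ d := by
      rw [Lagrange.natDegree_basis Function.injective_id.injOn hx, hcard]; simp
    have h1 := abs_eval_iterate_derivative_le hdeg (r + 1) (abs_le.2 ⟨hξ.1, hξ.2⟩)
      (B := (2 * 1 / σ) ^ d) (fun i => by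
        simpa using abs_coeff_basis_le hcard hσ0 hs1 hsep hx i)
    simp only [w]
    rw [h, iteratedDeriv_polynomial_eval, abs_div, Nat.abs_cast]
    refine (div_le_self (abs_nonneg _) ?_).trans h1
    exact_mod_cast Nat.succ_le_of_lt (Nat.factorial_pos _)
  refine ⟨discreteMeasure s w, fun t ht => hsK t (support_discreteMeasure s w ht), ?_, ?_⟩
  · intro P hP
    rw [linearCombination_discreteMeasure]
    have h1 := sum_eval_mul_basis (s := s) (P := P)
      (degree_le_natDegree.trans_lt (by rw [hcard]; norm_cast; omega))
    have h2 : ∀ t, P.eval t = ∑ x ∈ s, P.eval x * (Lagrange.basis s id x).eval t := by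
      intro t
      nth_rewrite 1 [← h1]
      simp [eval_finsetSum]
    simp only [smul_eq_mul, w, divDiff, Finset.sum_mul]
    rw [Finset.sum_comm]
    refine Finset.sum_congr rfl fun t _ => ?_
    rw [h2 t, Finset.sum_div]
    exact Finset.sum_congr rfl fun x _ => by ring
  · intro φ B hφ
    have h1 := abs_linearCombination_discreteMeasure_le (s := s) (w := w) (φ := φ) hw
      (fun x hx => hφ x (hsK x hx).2)
    rw [hcard] at h1
    push_cast at h1
    linarith

theorem natDegree_C_sub_X_pow_le (x : ℝ) (k : ℕ) : ((C x - X) ^ k : ℝ[X]).natDegree ≤ k := by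
  have h : (C x - X : ℝ[X]).natDegree ≤ 1 := (natDegree_sub_le _ _).trans (by simp)
  exact (natDegree_pow_le_of_le k h).trans (by simp)

theorem eval_polyOf (k : ℕ) (μ : ℝ →₀ ℝ) (x : ℝ) :
    (polyOf k μ).eval x = Finsupp.linearCombination ℝ (fun t => ((C x - X) ^ k : ℝ[X]).eval t) μ := by
  rw [polyOf_eq_sum, eval_finsetSum, Finsupp.linearCombination_apply, Finsupp.sum]
  simp

theorem abs_splineOf_le {k : ℕ} {μ : ℝ →₀ ℝ} {S : Set ℝ} {A L x : ℝ} (hL : 0 ≤ L)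
    (hμ : ∀ (φ : ℝ → ℝ) (B : ℝ), (∀ t ∈ S, |φ t| ≤ B) →
      |Finsupp.linearCombination ℝ φ μ| ≤ A * B) (hS : ∀ t ∈ S, x - t ≤ L) :
    |splineOf k μ x| ≤ A * L ^ k :=
  hμ _ _ fun t ht => abs_truncPow_le hL (hS t ht)

/-- A spline with compact support whose `q`-th derivative is large on `[0, R]`, and negative at
most on a given interval, where it is bounded below independently of `R`. -/
theorem exists_correction (q : ℕ) {r : ℕ} (hr : 1 ≤ r) {ρ : ℝ} (hρ : 0 < ρ) :
    ∃ L : ℝ, 0 < L ∧ ∀ (K : Set ℝ) (R u : ℝ), 0 < R → (2 * r + 4) * R ≤ 1 → -1 ≤ u → u + ρ ≤ 1 →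
      IsMeshDense K R → IsMeshDense K (ρ / (2 * (q + r + 1))) →
      ∃ η : ℝ →₀ ℝ,
        (∀ t ∈ η.support, t ∈ K ∧ t ∈ Icc (-2 * R) ((2 * r + 4) * R) ∪ Icc u (u + ρ)) ∧
        polyOf (q + r) η = 0 ∧
        (∀ x, x ∉ Icc u (u + ρ) → 0 ≤ splineOf r η x) ∧
        (∀ x ∈ Icc 0 R, x ∉ Icc u (u + ρ) →
          1 / ((2 * r + 6) ^ (r + 1) * R) ≤ splineOf r η x) ∧
        (∀ x ∈ Icc u (u + ρ), -L ≤ splineOf r η x) ∧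
        ∀ x ∈ Icc (-1 : ℝ) 1,
          |splineOf (q + r) η x| ≤ (r + 2) * (1 / R ^ (r + 1) * 2 ^ (q + r)) + L := by
  obtain ⟨A, hA, hmeas⟩ := exists_measure_eq_divDiff (q + r) r hρ
  refine ⟨A * 2 ^ (q + r), by positivity, fun K R u hR hR1 hu hu' hK hK' => ?_⟩
  obtain ⟨T, hcard, hTK, hTw, hTlow⟩ := exists_bspline r hR hR1 hK
  have hrR : 0 ≤ r * R := by positivity
  have hT1 : ∀ t ∈ T, t ∈ Icc (-1 : ℝ) 1 := fun t ht =>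
    ⟨by nlinarith [(hTK t ht).2.1], (hTK t ht).2.2.trans hR1⟩
  obtain ⟨ν, hνK, hνP, hνb⟩ := hmeas K u hu hu' (by push_cast; exact hK') T hcard hT1
  set δ : ℝ →₀ ℝ := discreteMeasure T fun t => 1 / ∏ y ∈ T.erase t, (t - y) with hδ
  have hδpair : ∀ φ : ℝ → ℝ, Finsupp.linearCombination ℝ φ δ = divDiff T φ := by
    intro φ
    rw [hδ, linearCombination_discreteMeasure]
    exact Finset.sum_congr rfl fun t _ => by rw [smul_eq_mul]; ring
  have hδs : ∀ x, (-1) ^ (r + 1) * splineOf r δ x = divDiff T (upperPow r x) := by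
    intro x
    rw [splineOf, hδpair, divDiff_congr (φ := upperPow r x)
      (ψ := fun t => ((X - C x) ^ r : ℝ[X]).eval t + (-1) ^ (r + 1) * truncPow r t x)
      (fun t _ => by
        have := upperPow_add_truncPow (r := r) (by omega) t x
        simp only [eval_pow, eval_sub, eval_X, eval_C, ← this, pow_succ]
        ring)]
    rw [divDiff_add, divDiff_polynomial_eq_zero (by simp [hcard]), zero_add, divDiff_const_mul]
  -- On degree at most `q + r`, `ν` acts as a divided difference of order `r + 1`, so it annihilates
  -- degree `r`. The `q`-th derivative level spline of `ν` therefore vanishes to the right of its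
  -- knots too.
  have hνr : polyOf r ν = 0 := by
    refine Polynomial.funext fun x => ?_
    rw [eval_polyOf, hνP _ ((natDegree_C_sub_X_pow_le x r).trans (by omega)),
      divDiff_polynomial_eq_zero, eval_zero]
    have := natDegree_C_sub_X_pow_le x r
    omega
  have hν0 : ∀ x, x ∉ Icc u (u + ρ) → splineOf r ν x = 0 := by
    intro x hx
    rcases lt_or_ge x u with h | h
    · exact splineOf_of_le fun t ht => h.le.trans (hνK t ht).2.1
    · have h' : u + ρ < x := by
        by_contra h2
        exact hx ⟨h, not_lt.1 h2⟩
      rw [splineOf_of_ge (by omega) fun t ht => (hνK t ht).2.2.trans h'.le, hνr, eval_zero]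
  -- The sign relating `(x - t)_+^r` to `(t - x)_+^r` under the divided difference; it makes the
  -- B-spline part nonnegative.
  set e : ℝ := (-1) ^ (r + 1) with he
  have he1 : |e| = 1 := by rw [he, abs_pow, abs_neg, abs_one, one_pow]
  have hsp : ∀ k x, splineOf k (e • (δ + (-1 : ℝ) • ν)) x
      = e * splineOf k δ x - e * splineOf k ν x := by
    intro k x
    rw [splineOf_smul, splineOf_add, splineOf_smul]; ring
  have hνb' : ∀ k x, x ∈ Icc (-1 : ℝ) 1 → |e * splineOf k ν x| ≤ A * 2 ^ k := by
    intro k x hx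
    rw [abs_mul, he1, one_mul]
    exact abs_splineOf_le (by norm_num) hνb fun t ht => by linarith [hx.2, ht.1]
  have h2pow : A * 2 ^ r ≤ A * 2 ^ (q + r) :=
    mul_le_mul_of_nonneg_left (pow_le_pow_right₀ (by norm_num) (by omega)) hA.le
  refine ⟨e • (δ + (-1 : ℝ) • ν), ?_, ?_, ?_, ?_, ?_, ?_⟩
  · intro t ht
    have h1 := Finsupp.support_add (Finsupp.support_smul ht)
    rcases Finset.mem_union.1 h1 with h2 | h2
    · have := hTK t (support_discreteMeasure _ _ h2)
      exact ⟨this.1, Or.inl this.2⟩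
    · have := hνK t (Finsupp.support_smul h2)
      exact ⟨this.1, Or.inr this.2⟩
  · rw [polyOf_smul, polyOf_add, polyOf_smul]
    -- Equal moments up to degree `q + r` make the two splines coincide beyond all knots.
    have : polyOf (q + r) δ = polyOf (q + r) ν := by
      refine Polynomial.funext fun x => ?_
      rw [eval_polyOf, eval_polyOf, hνP _ (natDegree_C_sub_X_pow_le x _), hδpair]
    rw [this]
    simp
  · intro x hx
    rw [hsp, hν0 x hx, hδs]
    simpa using divDiff_upperPow_nonneg r hcard x
  · intro x hx hxI
    rw [hsp, hν0 x hxI, hδs]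
    simpa using hTlow x hx
  · intro x hx
    rw [hsp, hδs]
    have h1 := divDiff_upperPow_nonneg r hcard x
    have h2 := (abs_le.1 (hνb' r x ⟨hu.trans hx.1, hx.2.trans hu'⟩)).2
    linarith
  · intro x hx
    rw [hsp]
    refine (abs_sub _ _).trans (add_le_add ?_ (hνb' _ x hx))
    rw [abs_mul, he1, one_mul, splineOf]
    refine (abs_linearCombination_discreteMeasure_le hTw fun t ht =>
      abs_truncPow_le (L := 2) (by norm_num) (by linarith [hx.2, (hT1 t ht).1])).trans ?_
    rw [hcard]
    push_cast
    exact le_rfl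

/-! ### Smoothing one normalized knot. -/

/-- Where the `q`-th derivatives of both pieces are nonnegative, one of them is bounded below by
the jump on some interval. -/
theorem exists_Icc_jump_le (q r : ℕ) : ∃ c ρ : ℝ, 0 < c ∧ 0 < ρ ∧ ∀ P₁ P₂ : ℝ[X],
    P₁.natDegree ≤ q + r → P₂.natDegree ≤ q + r → (∀ i < q, (P₂ - P₁).coeff i = 0) →
    (∀ x ∈ Icc (-1 : ℝ) 0, 0 ≤ (derivative^[q] P₁).eval x) →
    (∀ x ∈ Icc (0 : ℝ) 1, 0 ≤ (derivative^[q] P₂).eval x) →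
    ∃ u, (1 / 4 ≤ u ∧ u + ρ ≤ 3 / 4 ∧
        ∀ x ∈ Icc u (u + ρ), c * coeffNorm (q + r) (P₂ - P₁) ≤ (derivative^[q] P₂).eval x) ∨
      (-(3 / 4) ≤ u ∧ u + ρ ≤ -(1 / 4) ∧
        ∀ x ∈ Icc u (u + ρ), c * coeffNorm (q + r) (P₂ - P₁) ≤ (derivative^[q] P₁).eval x) := by
  obtain ⟨c₁, ρ₁, hc₁, hρ₁, h₁⟩ := exists_Icc_coeffNorm_le r (a := -(3 / 4)) (b := -(1 / 4))
    (by norm_num) (by norm_num) (by norm_num)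
  obtain ⟨c₂, ρ₂, hc₂, hρ₂, h₂⟩ := exists_Icc_coeffNorm_le r (a := 1 / 4) (b := 3 / 4)
    (by norm_num) (by norm_num) (by norm_num)
  refine ⟨min c₁ c₂ / 2, min ρ₁ ρ₂, by positivity, lt_min hρ₁ hρ₂,
    fun P₁ P₂ hP₁ hP₂ hD hf hg => ?_⟩
  set f := derivative^[q] P₁ with hfdef
  set g := derivative^[q] P₂ with hgdef
  set M := coeffNorm (q + r) (P₂ - P₁) with hM
  have hM0 : 0 ≤ M := coeffNorm_nonneg _ _
  have hfd : f.natDegree ≤ r := (natDegree_iterate_derivative P₁ q).trans (by omega)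
  have hgd : g.natDegree ≤ r := (natDegree_iterate_derivative P₂ q).trans (by omega)
  have hsum : M ≤ coeffNorm r g + coeffNorm r f := by
    refine (coeffNorm_le_coeffNorm_iterate_derivative hD).trans ?_
    rw [iterate_derivative_sub, ← hfdef, ← hgdef]
    have h3 : coeffNorm r (-f) = coeffNorm r f := by simp [coeffNorm]
    rw [sub_eq_add_neg, ← h3]
    exact coeffNorm_add_le _ _ _
  have hρl := min_le_left ρ₁ ρ₂
  have hρr := min_le_right ρ₁ ρ₂
  have hcl := min_le_left c₁ c₂
  have hcr := min_le_right c₁ c₂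
  -- One of the two `q`-th derivatives carries at least half of `M`. On its own side it is
  -- nonnegative, so the bound for the absolute value is a bound for the value.
  rcases le_total (M / 2) (coeffNorm r g) with h | h
  · obtain ⟨u, hu, hu', hI⟩ := h₂ g hgd
    refine ⟨u, Or.inl ⟨hu, by linarith, fun x hx => ?_⟩⟩
    have h3 := hI x ⟨hx.1, by linarith [hx.2]⟩
    rw [abs_of_nonneg (hg x ⟨by linarith [hx.1], by linarith [hx.2]⟩)] at h3
    nlinarith
  · obtain ⟨u, hu, hu', hI⟩ := h₁ f hfd
    refine ⟨u, Or.inr ⟨hu, by linarith, fun x hx => ?_⟩⟩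
    have h3 := hI x ⟨hx.1, by linarith [hx.2]⟩
    rw [abs_of_nonneg (hf x ⟨by linarith [hx.1], by linarith [hx.2]⟩)] at h3
    nlinarith [coeffNorm_nonneg r f]

/-- Smoothing of one knot, normalized to the knot `0` of `[-1, 1]`. -/
theorem exists_smoothing_measure (q : ℕ) {r : ℕ} (hr : 1 ≤ r) : ∃ ε A : ℝ, 0 < ε ∧ 0 < A ∧
    ∀ K : Set ℝ, IsMeshDense K ε → ∀ P₁ P₂ : ℝ[X],
    P₁.natDegree ≤ q + r → P₂.natDegree ≤ q + r → (∀ i < q, (P₂ - P₁).coeff i = 0) →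
    (∀ x ∈ Icc (-1 : ℝ) 0, 0 ≤ (derivative^[q] P₁).eval x) →
    (∀ x ∈ Icc (0 : ℝ) 1, 0 ≤ (derivative^[q] P₂).eval x) →
    ∃ μ : ℝ →₀ ℝ, (∀ t ∈ μ.support, t ∈ K ∧ t ∈ Icc (-(3 / 4) : ℝ) (3 / 4)) ∧
      polyOf (q + r) μ = P₂ - P₁ ∧
      (∀ x ∈ Icc (-1 : ℝ) 1,
        |splineOf (q + r) μ x| ≤ A * coeffNorm (q + r) (P₂ - P₁)) ∧
      ∀ x ∈ Icc (-1 : ℝ) 1, 0 ≤ (derivative^[q] P₁).eval x +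
        ((q + r).descFactorial q : ℝ) * splineOf r μ x := by
  obtain ⟨c, ρ, hc, hρ, hI⟩ := exists_Icc_jump_le q r
  obtain ⟨A, hA, hjump⟩ := exists_polyOf_eq q r
  obtain ⟨L, hL, hcorr⟩ := exists_correction q hr hρ
  set γ : ℝ := ((q + r).descFactorial q : ℝ) with hγ
  have hγ0 : 0 < γ := by
    rw [hγ]; exact_mod_cast Nat.descFactorial_pos.2 (by omega)
  -- Chosen so that `Λ R M` times the lower bound of the B-spline on `[0, R]` is exactly `2AM`, the
  -- possible defect there up to the factor `γ`.
  set Λ : ℝ := 2 * A * (2 * r + 6) ^ (r + 1) with hΛ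
  have hΛ0 : 0 < Λ := by positivity
  -- The first bound keeps the B-spline knots inside `[-1/4, 1/4]`, disjoint from the inner part of
  -- the sacrificed interval. The second makes the loss `γ Λ L R M` there at most `c M`.
  set R : ℝ := min (1 / (4 * (2 * r + 6))) (c / (γ * Λ * L)) with hR
  have hR0 : 0 < R := lt_min (by positivity) (by positivity)
  have hR1 : (2 * r + 6) * R ≤ 1 / 4 := by
    have h1 : R ≤ 1 / (4 * (2 * r + 6)) := min_le_left _ _
    calc (2 * r + 6) * R ≤ (2 * r + 6) * (1 / (4 * (2 * r + 6))) :=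
          mul_le_mul_of_nonneg_left h1 (by positivity)
      _ = 1 / 4 := by field_simp
  have hR2 : γ * Λ * L * R ≤ c := by
    have h1 : R ≤ c / (γ * Λ * L) := min_le_right _ _
    rw [le_div_iff₀ (by positivity)] at h1
    linarith
  have hrR : 0 ≤ r * R := by positivity
  set ε : ℝ := min (R / (2 * (q + r + 1))) (ρ / (2 * (q + r + 1))) with hε
  set B : ℝ := (r + 2) * (1 / R ^ (r + 1) * 2 ^ (q + r)) + L with hB
  refine ⟨ε, A * 2 ^ (q + r) / R ^ r + Λ * R * B, lt_min (by positivity) (by positivity),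
    by positivity, fun K hK P₁ P₂ hP₁ hP₂ hD hf hg => ?_⟩
  set M := coeffNorm (q + r) (P₂ - P₁) with hM
  have hM0 : 0 ≤ M := coeffNorm_nonneg _ _
  obtain ⟨u, hu⟩ := hI P₁ P₂ hP₁ hP₂ hD hf hg
  have hu1 : -(3 / 4) ≤ u ∧ u + ρ ≤ 3 / 4 := by
    rcases hu with ⟨h1, h2, -⟩ | ⟨h1, h2, -⟩ <;> constructor <;> linarith
  obtain ⟨μ, hμK, hμP, hμb⟩ := hjump K R hR0 (by linarith) (hK.mono (min_le_left _ _)) (P₂ - P₁)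
    ((natDegree_sub_le _ _).trans (max_le hP₂ hP₁)) hD
  obtain ⟨η, hηK, hηP, hη0, hηR, hηI, hηb⟩ := hcorr K R u hR0 (by linarith) (by linarith)
    (by linarith) (hK.mono ((min_le_left _ _).trans (div_le_self hR0.le (by
      have : (0 : ℝ) ≤ q := Nat.cast_nonneg _
      have : (0 : ℝ) ≤ r := Nat.cast_nonneg _
      linarith)))) (hK.mono (min_le_right _ _))
  have hRr : 0 < R ^ r := by positivity
  have hμb' : ∀ (φ : ℝ → ℝ) (B : ℝ), (∀ t ∈ Icc 0 R, |φ t| ≤ B) →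
      |Finsupp.linearCombination ℝ φ μ| ≤ A * M / R ^ r * B := by
    intro φ B hφ
    have := hμb φ B hφ
    rw [div_mul_eq_mul_div, le_div_iff₀ hRr]
    exact this
  have hder : ∀ x, γ * (polyOf r μ).eval x
      = (derivative^[q] P₂).eval x - (derivative^[q] P₁).eval x := by
    intro x
    rw [← eval_sub, ← iterate_derivative_sub, ← hμP, iterate_derivative_polyOf]
    simp [hγ]
  have hF0 : ∀ x ∈ Icc (-1 : ℝ) 1, x ∉ Icc 0 R →
      0 ≤ (derivative^[q] P₁).eval x + γ * splineOf r μ x := by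
    intro x hx hxR
    rcases le_or_gt x 0 with h | h
    · rw [splineOf_of_le fun t ht => h.trans (hμK t ht).2.1]
      simpa using hf x ⟨hx.1, h⟩
    · have h' : R ≤ x := by
        by_contra h2
        exact hxR ⟨h.le, (not_le.1 h2).le⟩
      rw [splineOf_of_ge (by omega) fun t ht => (hμK t ht).2.2.trans h', hder]
      simpa using hg x ⟨h.le, hx.2⟩
  -- The masses are `O(R^(-r))` and the powers `(x - t)^r` are at most `R^r`, so the defect does not
  -- depend on `R`. It is compared with the nonnegative `q`-th derivative of `P₂`.
  have hFR : ∀ x ∈ Icc 0 R, -(γ * (2 * (A * M))) ≤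
      (derivative^[q] P₁).eval x + γ * splineOf r μ x := by
    intro x hx
    have h1 : |splineOf r μ x| ≤ A * M := by
      have := abs_splineOf_le (k := r) (x := x) hR0.le hμb' fun t ht => by linarith [hx.2, ht.1]
      rwa [div_mul_cancel₀ _ hRr.ne'] at this
    have h2 : |(polyOf r μ).eval x| ≤ A * M := by
      rw [eval_polyOf]
      have := hμb' (fun t => ((C x - X) ^ r : ℝ[X]).eval t) (R ^ r) fun t ht => by
        simp only [eval_pow, eval_sub, eval_X, eval_C, abs_pow]
        exact pow_le_pow_left₀ (abs_nonneg _)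
          (abs_le.2 ⟨by linarith [hx.1, ht.2], by linarith [hx.2, ht.1]⟩) r
      rwa [div_mul_cancel₀ _ hRr.ne'] at this
    have h3 := hder x
    have h4 := hg x ⟨hx.1, by linarith [hx.2]⟩
    have h5 : γ * ((polyOf r μ).eval x - splineOf r μ x) ≤ γ * (2 * (A * M)) :=
      mul_le_mul_of_nonneg_left (by linarith [(abs_le.1 h1).1, (abs_le.1 h2).2]) hγ0.le
    linarith
  have hFI : ∀ x ∈ Icc u (u + ρ), x ∉ Icc 0 R ∧
      c * M ≤ (derivative^[q] P₁).eval x + γ * splineOf r μ x := by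
    intro x hx
    rcases hu with ⟨h1, h2, h3⟩ | ⟨h1, h2, h3⟩
    · have hRx : R < x := by linarith [hx.1]
      refine ⟨fun h => by linarith [h.2], ?_⟩
      rw [splineOf_of_ge (by omega) fun t ht => (hμK t ht).2.2.trans hRx.le, hder]
      linarith [h3 x hx]
    · have hx0 : x < 0 := by linarith [hx.2]
      refine ⟨fun h => by linarith [h.1], ?_⟩
      rw [splineOf_of_le fun t ht => hx0.le.trans (hμK t ht).2.1]
      linarith [h3 x hx]
  have hlam : 0 ≤ Λ * R * M := by positivity
  refine ⟨μ + (Λ * R * M) • η, ?_, ?_, ?_, ?_⟩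
  · intro t ht
    rcases Finset.mem_union.1 (Finsupp.support_add ht) with h | h
    · have := hμK t h
      exact ⟨this.1, by linarith [this.2.1], by linarith [this.2.2]⟩
    · have h1 := hηK t (Finsupp.support_smul h)
      refine ⟨h1.1, ?_⟩
      rcases h1.2 with h2 | h2
      · exact ⟨by linarith [h2.1], by linarith [h2.2]⟩
      · exact ⟨by linarith [h2.1], by linarith [h2.2]⟩
  · rw [polyOf_add, polyOf_smul, hηP, hμP]; simp
  · intro x hx
    rw [splineOf_add, splineOf_smul]
    refine (abs_add_le _ _).trans ?_
    have h1 := abs_splineOf_le (k := q + r) (x := x) (L := 2) (by norm_num) hμb'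
      fun t ht => by linarith [hx.2, ht.1]
    have h2 := mul_le_mul_of_nonneg_left (hηb x hx) hlam
    rw [abs_mul, abs_of_nonneg hlam]
    calc _ ≤ A * M / R ^ r * 2 ^ (q + r) + Λ * R * M * B := add_le_add h1 h2
      _ = _ := by ring
  · intro x hx
    rw [splineOf_add, splineOf_smul, mul_add, ← add_assoc]
    by_cases hxI : x ∈ Icc u (u + ρ)
    · have h1 := (hFI x hxI).2
      have h2 := mul_le_mul_of_nonneg_left (hηI x hxI) hlam
      have h3 := mul_le_mul_of_nonneg_left h2 hγ0.le
      have h4 := mul_le_mul_of_nonneg_right hR2 hM0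
      linarith
    · by_cases hxR : x ∈ Icc 0 R
      · have h1 := hFR x hxR
        have h2 := mul_le_mul_of_nonneg_left (hηR x hxR hxI) hlam
        have h3 : Λ * R * M * (1 / ((2 * r + 6) ^ (r + 1) * R)) = 2 * (A * M) := by
          rw [hΛ]; field_simp
        rw [h3] at h2
        have h4 := mul_le_mul_of_nonneg_left h2 hγ0.le
        linarith
      · have h1 := hF0 x hx hxR
        have h2 := mul_nonneg hγ0.le (mul_nonneg hlam (hη0 x hxI))
        linarith

/-! ### Rescaling to an arbitrary knot. -/

/-- The polynomial `P(z + h X)`. -/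
noncomputable def rescale (z h : ℝ) (P : ℝ[X]) : ℝ[X] := P.comp (C h * X + C z)

theorem eval_rescale (z h : ℝ) (P : ℝ[X]) (y : ℝ) : (rescale z h P).eval y = P.eval (h * y + z) := by
  simp [rescale]

theorem rescale_sub (z h : ℝ) (P Q : ℝ[X]) :
    rescale z h (P - Q) = rescale z h P - rescale z h Q := by simp [rescale]

theorem natDegree_rescale_le {z h : ℝ} {P : ℝ[X]} {d : ℕ} (hP : P.natDegree ≤ d) :
    (rescale z h P).natDegree ≤ d := by
  refine natDegree_comp_le.trans ?_
  have h1 : (C h * X + C z : ℝ[X]).natDegree ≤ 1 := natDegree_linear_le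
  nlinarith [Nat.zero_le P.natDegree]

theorem iterate_derivative_rescale (z h : ℝ) (n : ℕ) (P : ℝ[X]) :
    derivative^[n] (rescale z h P) = C (h ^ n) * rescale z h (derivative^[n] P) := by
  induction n with
  | zero => simp
  | succ n ih =>
    rw [Function.iterate_succ_apply', ih, Function.iterate_succ_apply', derivative_C_mul, rescale,
      derivative_comp, rescale]
    simp only [derivative_add, derivative_mul, derivative_C, derivative_X, zero_mul, mul_one,
      zero_add, add_zero, pow_succ, C_mul]
    ring

/-- The coefficient is `h^i / i!` times the `i`-th derivative at `z`. It turns matching derivatives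
at the knot into vanishing low coefficients of the jump. -/
theorem coeff_rescale_eq_zero {z h : ℝ} {P : ℝ[X]} {i : ℕ}
    (hP : (derivative^[i] P).eval z = 0) : (rescale z h P).coeff i = 0 := by
  have h1 := coeff_iterate_derivative (k := i) (rescale z h P) 0
  rw [iterate_derivative_rescale, coeff_C_mul, coeff_zero_eq_eval_zero, eval_rescale, mul_zero,
    zero_add, hP, mul_zero, zero_add, Nat.descFactorial_self, nsmul_eq_mul] at h1
  exact (mul_eq_zero.1 h1.symm).resolve_left (by exact_mod_cast i.factorial_ne_zero)

theorem iteratedDeriv_comp_rescale {n : ℕ} {f : ℝ → ℝ} (hf : ContDiff ℝ n f) (z h x : ℝ) :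
    iteratedDeriv n (fun x => f (h⁻¹ * (x - z))) x
      = (h⁻¹) ^ n * iteratedDeriv n f (h⁻¹ * (x - z)) := by
  have h1 := iteratedDeriv_comp_sub_const n (fun y => f (h⁻¹ * y)) z
  have h2 := iteratedDeriv_comp_const_mul hf h⁻¹
  rw [h1, h2]

/-- Smoothing of one knot. -/
theorem exists_transition (q : ℕ) {r : ℕ} (hr : 1 ≤ r) : ∃ ε A : ℝ, 0 < ε ∧ 0 < A ∧
    ∀ (K : Set ℝ) (z h : ℝ), 0 < h →
    (∀ u, z - h ≤ u → u + ε * h ≤ z + h → ∃ t ∈ K, t ∈ Icc u (u + ε * h)) →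
    ∀ P₁ P₂ : ℝ[X], P₁.natDegree ≤ q + r → P₂.natDegree ≤ q + r →
    (∀ i < q, (derivative^[i] P₁).eval z = (derivative^[i] P₂).eval z) →
    (∀ x ∈ Icc (z - h) z, 0 ≤ (derivative^[q] P₁).eval x) →
    (∀ x ∈ Icc z (z + h), 0 ≤ (derivative^[q] P₂).eval x) →
    ∃ a : ℝ → ℝ, ContDiff ℝ (q + r - 1 : ℕ) a ∧
      (∀ x < z - 3 / 4 * h, a x = 0) ∧ (∀ x > z + 3 / 4 * h, a x = P₂.eval x - P₁.eval x) ∧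
      (∀ c e, (∀ t ∈ K, t ∉ Ioo c e) →
        ∃ Q : ℝ[X], Q.natDegree ≤ q + r ∧ ∀ x ∈ Ioo c e, a x = Q.eval x) ∧
      (∀ x ∈ Icc (z - h) (z + h), |a x| ≤ A * coeffNorm (q + r) (rescale z h (P₂ - P₁))) ∧
      ∀ x ∈ Icc (z - h) (z + h), 0 ≤ (derivative^[q] P₁).eval x + iteratedDeriv q a x := by
  obtain ⟨ε, A, hε, hA, hmain⟩ := exists_smoothing_measure q hr
  refine ⟨ε, A, hε, hA, fun K z h hh hK P₁ P₂ hP₁ hP₂ hz hf hg => ?_⟩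
  have hmem : ∀ {x}, x ∈ Icc (z - h) (z + h) → h⁻¹ * (x - z) ∈ Icc (-1 : ℝ) 1 := by
    intro x hx
    constructor
    · rw [le_inv_mul_iff₀ hh]; linarith [hx.1]
    · rw [inv_mul_le_iff₀ hh]; linarith [hx.2]
  have hback : ∀ x, h * (h⁻¹ * (x - z)) + z = x := fun x => by field_simp; ring
  obtain ⟨μ, hμK, hμP, hμb, hμ0⟩ := hmain {y | h * y + z ∈ K} (by
      intro u hu hu'
      obtain ⟨t, htK, ht1, ht2⟩ := hK (h * u + z) (by nlinarith) (by nlinarith)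
      refine ⟨h⁻¹ * (t - z), by simpa [hback] using htK, ?_, ?_⟩
      · rw [le_inv_mul_iff₀ hh]; linarith
      · rw [inv_mul_le_iff₀ hh]; linarith)
    (rescale z h P₁) (rescale z h P₂) (natDegree_rescale_le hP₁) (natDegree_rescale_le hP₂)
    (fun i hi => by
      rw [← rescale_sub]
      refine coeff_rescale_eq_zero ?_
      rw [iterate_derivative_sub, eval_sub, hz i hi, sub_self])
    (fun x hx => by
      rw [iterate_derivative_rescale, eval_mul, eval_C, eval_rescale]
      exact mul_nonneg (by positivity) (hf _ ⟨by nlinarith [hx.1], by nlinarith [hx.2]⟩))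
    (fun x hx => by
      rw [iterate_derivative_rescale, eval_mul, eval_C, eval_rescale]
      exact mul_nonneg (by positivity) (hg _ ⟨by nlinarith [hx.1], by nlinarith [hx.2]⟩))
  have hcd : ContDiff ℝ (q + r - 1 : ℕ) (splineOf (q + r) μ) := by
    have := contDiff_splineOf (q + r - 1) μ
    rwa [show q + r - 1 + 1 = q + r by omega] at this
  refine ⟨fun x => splineOf (q + r) μ (h⁻¹ * (x - z)), ?_, ?_, ?_, ?_, ?_, ?_⟩
  · exact hcd.comp (contDiff_const.mul (contDiff_id.sub contDiff_const))
  · intro x hx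
    refine splineOf_of_le fun t ht => ?_
    have := (hμK t ht).2.1
    rw [inv_mul_le_iff₀ hh]
    nlinarith
  · intro x hx
    simp only
    rw [splineOf_of_ge (by omega) fun t ht => ?_, hμP, eval_sub, eval_rescale, eval_rescale, hback]
    have := (hμK t ht).2.2
    rw [le_inv_mul_iff₀ hh]
    nlinarith
  · intro c e hce
    obtain ⟨Q, hQ, hQe⟩ := splineOf_eq_polynomial (q + r) (μ := μ) (a := h⁻¹ * (c - z))
      (b := h⁻¹ * (e - z)) (fun t ht hte => hce _ (hμK t ht).1 (by
        have h1 := hte.1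
        have h2 := hte.2
        rw [inv_mul_lt_iff₀ hh] at h1
        rw [lt_inv_mul_iff₀ hh] at h2
        exact ⟨by linarith, by linarith⟩))
    refine ⟨rescale (-(h⁻¹ * z)) h⁻¹ Q, natDegree_rescale_le hQ, fun x hx => ?_⟩
    have hpos : 0 < h⁻¹ := by positivity
    rw [eval_rescale]
    simp only
    rw [hQe _ ⟨mul_lt_mul_of_pos_left (by linarith [hx.1]) hpos,
      mul_lt_mul_of_pos_left (by linarith [hx.2]) hpos⟩]
    congr 1
    ring
  · intro x hx
    rw [rescale_sub]
    exact hμb _ (hmem hx)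
  · intro x hx
    have h1 := hμ0 _ (hmem hx)
    rw [iteratedDeriv_comp_rescale (hcd.of_le (by exact_mod_cast (by omega : q ≤ q + r - 1))),
      iteratedDeriv_splineOf q hr]
    rw [iterate_derivative_rescale, eval_mul, eval_C, eval_rescale, hback] at h1
    have h2 : 0 < (h⁻¹) ^ q := by positivity
    have h3 := mul_nonneg h2.le h1
    have h4 : (h⁻¹) ^ q * h ^ q = 1 := by rw [← mul_pow, inv_mul_cancel₀ hh.ne', one_pow]
    calc (0 : ℝ) ≤ _ := h3
      _ = ((h⁻¹) ^ q * h ^ q) * (derivative^[q] P₁).eval x + (h⁻¹) ^ q *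
          (((q + r).descFactorial q : ℝ) * splineOf r μ (h⁻¹ * (x - z))) := by ring
      _ = _ := by rw [h4, one_mul]

/-! ### Pieces at the knots; the jump and the modulus of smoothness. -/

/-- A `C^k` function which is a polynomial on an open interval has the derivatives of that
polynomial on the closed interval. -/
theorem iteratedDerivWithin_eq_of_eqOn_Ioo {a b u v : ℝ} {k i : ℕ} {s : ℝ → ℝ} {P : ℝ[X]}
    (hs : ContDiffOn ℝ k s (Icc a b)) (hi : i ≤ k) (hau : a ≤ u) (huv : u < v) (hvb : v ≤ b)
    (hP : ∀ x ∈ Ioo u v, s x = P.eval x) :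
    ∀ x ∈ Icc u v, iteratedDerivWithin i s (Icc a b) x = (derivative^[i] P).eval x := by
  have hu : UniqueDiffOn ℝ (Icc a b) := uniqueDiffOn_Icc (by linarith)
  have hsub : Icc u v ⊆ Icc a b := Icc_subset_Icc hau hvb
  have hoo : EqOn (iteratedDerivWithin i s (Icc a b)) (fun x => (derivative^[i] P).eval x)
      (Ioo u v) := by
    intro x hx
    have hxI : x ∈ Icc a b := hsub (Ioo_subset_Icc_self hx)
    have h1 : s =ᶠ[nhdsWithin x (Icc a b)] fun x => P.eval x := by
      filter_upwards [mem_nhdsWithin_of_mem_nhds (Ioo_mem_nhds hx.1 hx.2)] with y hy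
      exact hP y hy
    rw [h1.iteratedDerivWithin_eq (hP x hx),
      iteratedDerivWithin_eq_iteratedDeriv hu (contDiff_polynomial_eval P _).contDiffAt hxI,
      iteratedDeriv_polynomial_eval]
  refine hoo.of_subset_closure ?_ (derivative^[i] P).continuous.continuousOn
    Ioo_subset_Icc_self (closure_Ioo huv.ne).ge
  exact (hs.continuousOn_iteratedDerivWithin (by exact_mod_cast hi) hu).mono hsub

theorem sum_choose_mul_eval_eq_zero {P : ℝ[X]} {k : ℕ} (hP : P.natDegree < k) (y t : ℝ) :
    ∑ i ∈ Finset.range (k + 1), (k.choose i : ℝ) * (-1) ^ (k - i) * P.eval (y + i * t) = 0 := by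
  have h1 : (rescale y t P).natDegree < k := (natDegree_rescale_le le_rfl).trans_lt hP
  have h2 := congrFun (Polynomial.fwdDiff_iter_eq_zero_of_degree_lt h1) 0
  rw [fwdDiff_iter_eq_sum_shift] at h2
  rw [← h2.trans (Pi.zero_apply _)]
  refine Finset.sum_congr rfl fun i _ => ?_
  rw [eval_rescale]
  simp only [zero_add, nsmul_eq_mul, mul_one, zsmul_eq_mul]
  push_cast
  rw [add_comm y, mul_comm t]
  ring

/-- Lower bound of the modulus of smoothness by the jump at one knot. -/
theorem exists_jump_le_localModulus (d : ℕ) : ∃ b ρ : ℝ, 0 < b ∧ 0 < ρ ∧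
    ∀ (u v z h : ℝ) (s : ℝ → ℝ) (P₁ P₂ : ℝ[X]), 0 < h → u ≤ z - h → z + h ≤ v →
    P₁.natDegree ≤ d → P₂.natDegree ≤ d →
    (∀ x ∈ Icc (z - h) z, s x = P₁.eval x) → (∀ x ∈ Icc z (z + h), s x = P₂.eval x) →
    ∀ p : ℝ≥0∞, 0 < p →
      ENNReal.ofReal (b * coeffNorm d (rescale z h (P₂ - P₁))) *
        ENNReal.ofReal (ρ * h) ^ (1 / p.toReal) ≤ localModulus (d + 1) s (Icc u v) p := by
  obtain ⟨b, ρ, hb, hρ, hI⟩ := exists_Icc_coeffNorm_le d (a := 0) (b := 1 / (d + 1))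
    (by norm_num) (by positivity)
    (by rw [div_le_one (by positivity)]; linarith [(Nat.cast_nonneg d : (0 : ℝ) ≤ d)])
  refine ⟨b, ρ, hb, hρ, fun u v z h s P₁ P₂ hh hu hv hP₁ hP₂ hs₁ hs₂ p hp => ?_⟩
  obtain ⟨w, hw, hw', hlow⟩ := hI (rescale z h (P₂ - P₁))
    (natDegree_rescale_le ((natDegree_sub_le _ _).trans (max_le hP₂ hP₁)))
  set M := coeffNorm d (rescale z h (P₂ - P₁)) with hM
  have hM0 : 0 ≤ M := coeffNorm_nonneg _ _
  -- The `d + 2` nodes of the difference then span exactly `h`. For centres in `S`, only the last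
  -- node passes `z`, and it lies within `t` of `z`; this is why the polynomial was bounded below on
  -- `[0, 1/(d+1)]`.
  set t : ℝ := h / (d + 1) with ht
  have ht0 : 0 < t := by positivity
  have hdt : (d + 1) * t = h := by rw [ht]; field_simp
  have htv : t ≤ volume.real (Icc u v) := by
    rw [Real.volume_real_Icc_of_le (by linarith)]
    nlinarith [(Nat.cast_nonneg d : (0 : ℝ) ≤ d)]
  set S : Set ℝ := Icc (z - h / 2 + h * w) (z - h / 2 + h * (w + ρ)) with hS
  have hy : ∀ x ∈ S, x + h / 2 - z ∈ Icc 0 t ∧ (x + h / 2 - z) / h ∈ Icc w (w + ρ) := by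
    intro x hx
    have h1 : h * (w + ρ) ≤ t := by
      calc h * (w + ρ) ≤ h * (1 / (d + 1)) := mul_le_mul_of_nonneg_left hw' hh.le
        _ = t := by rw [ht]; ring
    refine ⟨⟨by nlinarith [hx.1], by linarith [hx.2]⟩, ?_, ?_⟩
    · rw [le_div_iff₀ hh]; linarith [hx.1]
    · rw [div_le_iff₀ hh]; linarith [hx.2]
  have htd : t ≤ h := by nlinarith [(Nat.cast_nonneg d : (0 : ℝ) ≤ d)]
  have hSJ : S ⊆ Icc u v := fun x hx =>
    ⟨by linarith [(hy x hx).1.1], by linarith [(hy x hx).1.2]⟩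
  have hval : ∀ x ∈ S, b * M ≤ |symmDifference (d + 1) t s (Icc u v) x| := by
    intro x hx
    obtain ⟨⟨hy0, hyt⟩, hyw⟩ := hy x hx
    have hkt : ((d + 1 : ℕ) : ℝ) * t / 2 = h / 2 := by push_cast; rw [hdt]
    have hmem : x ∈ {x | x - ((d + 1 : ℕ) : ℝ) * t / 2 ∈ Icc u v ∧
        x + ((d + 1 : ℕ) : ℝ) * t / 2 ∈ Icc u v} := by
      rw [mem_ofPred_eq, hkt]
      exact ⟨⟨by linarith, by linarith⟩, ⟨by linarith, by linarith⟩⟩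
    rw [symmDifference, indicator_of_mem hmem, hkt]
    have hlast : s (x - h / 2 + ((d + 1 : ℕ) : ℝ) * t) = P₁.eval (x - h / 2 + ((d + 1 : ℕ) : ℝ) * t)
        + (rescale z h (P₂ - P₁)).eval ((x + h / 2 - z) / h) := by
      have e1 : x - h / 2 + ((d + 1 : ℕ) : ℝ) * t = x + h / 2 := by push_cast; rw [hdt]; ring
      have e2 : h * ((x + h / 2 - z) / h) + z = x + h / 2 := by field_simp; ring
      rw [e1, hs₂ _ ⟨by linarith, by linarith⟩, eval_rescale, e2, eval_sub]
      ring
    have hfirst : ∀ i ∈ Finset.range (d + 1),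
        ((d + 1).choose i : ℝ) * (-1) ^ (d + 1 - i) * s (x - h / 2 + i * t)
        = ((d + 1).choose i : ℝ) * (-1) ^ (d + 1 - i) * P₁.eval (x - h / 2 + i * t) := by
      intro i hi
      have h1 : (i : ℝ) ≤ d := by exact_mod_cast Nat.lt_succ_iff.1 (Finset.mem_range.1 hi)
      have h2 : (i : ℝ) * t ≤ h - t := by nlinarith
      have h3 : 0 ≤ (i : ℝ) * t := by positivity
      rw [hs₁ _ ⟨by linarith, by linarith⟩]
    -- Replacing `P₂` by `P₁ + D` at the last node, the `P₁` part is annihilated and a single value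
    -- of `D` remains.
    have hzero := sum_choose_mul_eval_eq_zero (k := d + 1) (by omega : P₁.natDegree < d + 1)
      (x - h / 2) t
    rw [Finset.sum_range_succ] at hzero ⊢
    rw [Finset.sum_congr rfl hfirst, hlast, mul_add, ← add_assoc, hzero, zero_add]
    simpa using hlow _ hyw
  have hvolS : (volume.restrict (Icc u v)) S = ENNReal.ofReal (ρ * h) := by
    rw [Measure.restrict_apply measurableSet_Icc, inter_eq_left.2 hSJ, Real.volume_Icc]
    congr 1
    ring
  calc ENNReal.ofReal (b * M) * ENNReal.ofReal (ρ * h) ^ (1 / p.toReal)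
      = eLpNorm (S.indicator fun _ => b * M) p (volume.restrict (Icc u v)) := by
        rw [eLpNorm_indicator_const' measurableSet_Icc _ hp.ne', hvolS,
          Real.enorm_eq_ofReal (by positivity)]
        rw [hvolS]
        simpa using mul_pos hρ hh
    _ ≤ LpNormOn (symmDifference (d + 1) t s (Icc u v)) p (Icc u v) := by
        refine eLpNorm_mono fun x => ?_
        by_cases hx : x ∈ S
        · rw [indicator_of_mem hx, Real.norm_of_nonneg (by positivity)]
          exact hval x hx
        · rw [indicator_of_notMem hx, norm_zero]
          exact norm_nonneg _
    _ ≤ _ := le_iSup₂_of_le (f := fun h (_ : h ∈ Ioc (0 : ℝ) (volume.real (Icc u v))) =>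
        LpNormOn (symmDifference (d + 1) h s (Icc u v)) p (Icc u v)) t ⟨ht0, htv⟩ le_rfl

theorem LpNormOn_le_of_abs_le {u v z h B : ℝ} {f : ℝ → ℝ} (hB : 0 ≤ B)
    (hf : ∀ x ∈ Icc u v, x ∉ Icc (z - h) (z + h) → f x = 0)
    (hfB : ∀ x ∈ Icc (z - h) (z + h), |f x| ≤ B) (p : ℝ≥0∞) :
    LpNormOn f p (Icc u v) ≤ ENNReal.ofReal B * ENNReal.ofReal (2 * h) ^ (1 / p.toReal) := by
  calc LpNormOn f p (Icc u v)
      ≤ eLpNorm ((Icc (z - h) (z + h)).indicator fun _ => B) p (volume.restrict (Icc u v)) := by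
        refine eLpNorm_mono_ae (ae_restrict_of_forall_mem measurableSet_Icc fun x hx => ?_)
        by_cases hxz : x ∈ Icc (z - h) (z + h)
        · rw [indicator_of_mem hxz, Real.norm_of_nonneg hB]
          exact hfB x hxz
        · rw [indicator_of_notMem hxz, hf x hx hxz]
    _ ≤ ‖B‖ₑ * (volume.restrict (Icc u v)) (Icc (z - h) (z + h)) ^ (1 / p.toReal) :=
        eLpNorm_indicator_const_le _ _
    _ ≤ _ := by
        rw [Real.enorm_eq_ofReal hB]
        gcongr
        refine (Measure.restrict_apply_le _ _).trans ?_
        rw [Real.volume_Icc]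
        exact ENNReal.ofReal_le_ofReal (by linarith)

/-! ### Density of the uniform and Chebyshev meshes near old knots. -/

/-- Half of the distance from the knot `z j` to the closest neighbouring knot. -/
noncomputable def halfGap (z : ℕ → ℝ) (j : ℕ) : ℝ := min (z j - z (j - 1)) (z (j + 1) - z j) / 2

theorem uniformKnot_zero (n : ℕ) : uniformKnot n 0 = -1 := by simp [uniformKnot]

theorem uniformKnot_self {n : ℕ} (hn : 1 ≤ n) : uniformKnot n n = 1 := by
  have : (n : ℝ) ≠ 0 := by positivity
  rw [uniformKnot]
  field_simp
  norm_num

theorem uniformKnot_lt_succ {n i : ℕ} (hi : i < n) : uniformKnot n i < uniformKnot n (i + 1) := by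
  have : (0 : ℝ) < n := by exact_mod_cast (Nat.zero_le i).trans_lt hi
  unfold uniformKnot
  push_cast
  gcongr
  linarith

theorem chebyshevKnot_zero (n : ℕ) : chebyshevKnot n 0 = -1 := by simp [chebyshevKnot]

theorem chebyshevKnot_self {n : ℕ} (hn : 1 ≤ n) : chebyshevKnot n n = 1 := by
  have : (n : ℝ) ≠ 0 := by positivity
  rw [chebyshevKnot, mul_div_assoc, mul_div_cancel₀ _ this]
  simp

theorem chebyshevKnot_lt_succ {n i : ℕ} (hi : i < n) :
    chebyshevKnot n i < chebyshevKnot n (i + 1) := by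
  have hn : (0 : ℝ) < n := by exact_mod_cast (Nat.zero_le i).trans_lt hi
  have hi' : (i : ℝ) + 1 ≤ n := by exact_mod_cast hi
  unfold chebyshevKnot
  push_cast
  refine neg_lt_neg (Real.cos_lt_cos_of_nonneg_of_le_pi (by positivity) ?_ ?_)
  · rw [div_le_iff₀ hn, mul_comm]
    exact mul_le_mul_of_nonneg_left hi' Real.pi_pos.le
  · gcongr
    linarith

/-- The half gap is `1/n`, and the new spacing `2/m` is at most `ε/n`; round up. The factor 16 is
dictated by the Chebyshev case. -/
theorem exists_uniformKnot_mem {ε : ℝ} (hε : 0 < ε) {n m j : ℕ} (hm : 16 / ε * n ≤ m)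
    (hj : 1 ≤ j) (hjn : j < n) {u : ℝ}
    (hu : uniformKnot n j - halfGap (uniformKnot n) j ≤ u)
    (hu' : u + ε * halfGap (uniformKnot n) j ≤ uniformKnot n j + halfGap (uniformKnot n) j) :
    ∃ i ≤ m, uniformKnot m i ∈ Icc u (u + ε * halfGap (uniformKnot n) j) := by
  have hn : (0 : ℝ) < n := by exact_mod_cast (Nat.zero_le j).trans_lt hjn
  have hm0 : (0 : ℝ) < m := lt_of_lt_of_le (by positivity) hm
  have hj1 : (1 : ℝ) ≤ j := by exact_mod_cast hj
  have hjn' : (j : ℝ) + 1 ≤ n := by exact_mod_cast hjn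
  have hgap : halfGap (uniformKnot n) j = 1 / n := by
    unfold halfGap uniformKnot
    rw [Nat.cast_sub hj]
    push_cast
    rw [show -1 + 2 * (j : ℝ) / n - (-1 + 2 * (j - 1) / n) = 2 / n by ring,
      show -1 + 2 * ((j : ℝ) + 1) / n - (-1 + 2 * j / n) = 2 / n by ring, min_self]
    ring
  rw [hgap] at hu hu' ⊢
  unfold uniformKnot at hu hu' ⊢
  have h1 : -1 ≤ u := by
    refine le_trans ?_ hu
    rw [show -1 + 2 * (j : ℝ) / n - 1 / n = -1 + (2 * j - 1) / n by ring]
    have : 0 ≤ (2 * (j : ℝ) - 1) / n := div_nonneg (by linarith) hn.le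
    linarith
  have h2 : u + ε * (1 / n) ≤ 1 := by
    refine hu'.trans ?_
    rw [show -1 + 2 * (j : ℝ) / n + 1 / n = -1 + (2 * j + 1) / n by ring]
    have : (2 * (j : ℝ) + 1) / n ≤ 2 := by rw [div_le_iff₀ hn]; linarith
    linarith
  have h3 : 2 / m ≤ ε * (1 / n) := by
    rw [div_mul_eq_mul_div, div_le_iff₀ hε] at hm
    rw [mul_one_div, div_le_div_iff₀ hm0 hn]
    linarith
  set i : ℕ := ⌈(u + 1) * m / 2⌉₊ with hi
  have h4 : (u + 1) * m / 2 ≤ i := Nat.le_ceil _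
  have h5 : (i : ℝ) < (u + 1) * m / 2 + 1 := Nat.ceil_lt_add_one (by
    have : 0 ≤ u + 1 := by linarith
    positivity)
  have h6 : u ≤ -1 + 2 * (i : ℝ) / m := by
    have : u + 1 ≤ 2 * (i : ℝ) / m := by rw [le_div_iff₀ hm0]; linarith
    linarith
  have h7 : -1 + 2 * (i : ℝ) / m ≤ u + ε * (1 / n) := by
    have : 2 * (i : ℝ) / m ≤ u + 1 + 2 / m := by
      rw [div_le_iff₀ hm0, add_mul, div_mul_cancel₀ _ hm0.ne']; linarith
    linarith
  refine ⟨i, ?_, h6, h7⟩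
  have h8 : 2 * (i : ℝ) / m ≤ 2 := by linarith
  rw [div_le_iff₀ hm0] at h8
  have : (i : ℝ) ≤ m := by linarith
  exact_mod_cast this

/-- Concavity of sine on `[0, π]` gives `sin y ≥ (y/x) sin x`. -/
theorem sin_div_four_le_sin_of_le {x y : ℝ} (hx : x ≤ Real.pi) (hy0 : 0 ≤ y)
    (hxy : x / 4 ≤ y) (hyx : y ≤ x) : Real.sin x / 4 ≤ Real.sin y := by
  rcases (hy0.trans hyx).eq_or_lt with h | h
  · have : y = 0 := by linarith
    simp [← h, this]
  · have h1 : 0 ≤ y / x := by positivity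
    have h2 : y / x ≤ 1 := div_le_one_of_le₀ hyx h.le
    have h3 := strictConcaveOn_sin_Icc.concaveOn.2 (x := x) ⟨h.le, hx⟩ (y := 0)
      ⟨le_rfl, Real.pi_pos.le⟩ h1 (sub_nonneg.2 h2) (by ring)
    simp only [smul_eq_mul, Real.sin_zero, mul_zero, add_zero, div_mul_cancel₀ _ h.ne'] at h3
    have h4 : 1 / 4 ≤ y / x := by rw [le_div_iff₀ h]; linarith
    nlinarith [Real.sin_nonneg_of_nonneg_of_le_pi h.le hx]

theorem sin_div_four_le_sin {x y : ℝ} (hx0 : 0 ≤ x) (hx : x ≤ Real.pi) (hxy : x / 4 ≤ y)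
    (hxy' : (Real.pi - x) / 4 ≤ Real.pi - y) : Real.sin x / 4 ≤ Real.sin y := by
  rcases le_total y x with h | h
  · exact sin_div_four_le_sin_of_le hx (by linarith) hxy h
  · rw [← Real.sin_pi_sub x, ← Real.sin_pi_sub y]
    exact sin_div_four_le_sin_of_le (by linarith) (by linarith) hxy' (by linarith)

theorem cos_sub_cos_eq (a b : ℝ) :
    Real.cos a - Real.cos b = 2 * Real.sin ((a + b) / 2) * Real.sin ((b - a) / 2) := by
  rw [Real.cos_sub_cos, show (a - b) / 2 = -((b - a) / 2) by ring, Real.sin_neg]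
  ring

/-- Each neighbouring gap is `2 sin(midpoint) sin(π/(2n))`. Jordan's inequality bounds the second
sine below by `1/n`, and the first is at least a quarter of `sin x`. The ratio 4 is attained at `j =
1`, between the angles `2π/n` and `π/(2n)`. -/
theorem le_halfGap_chebyshevKnot {n j : ℕ} (hj : 1 ≤ j) (hjn : j < n) {x : ℝ}
    (hx : ((j : ℝ) - 1) * Real.pi / n ≤ x) (hx' : x ≤ ((j : ℝ) + 1) * Real.pi / n) :
    Real.sin x / (4 * n) ≤ halfGap (chebyshevKnot n) j := by
  have hn : (0 : ℝ) < n := by exact_mod_cast (Nat.zero_le j).trans_lt hjn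
  have hj1 : (1 : ℝ) ≤ j := by exact_mod_cast hj
  have hjn' : (j : ℝ) + 1 ≤ n := by exact_mod_cast hjn
  have hpi := Real.pi_pos
  set l : ℝ := Real.pi / n with hl
  have hl0 : 0 < l := by positivity
  have hnl : n * l = Real.pi := by rw [hl]; field_simp
  rw [mul_div_assoc, ← hl] at hx hx'
  have hx0 : 0 ≤ x := le_trans (by nlinarith) hx
  have hxpi : x ≤ Real.pi := hx'.trans (by rw [← hnl]; nlinarith)
  have hgap : ∀ a : ℝ, (j : ℝ) - 1 ≤ a → a ≤ j →
      Real.sin x / (2 * n) ≤ Real.cos (a * l) - Real.cos ((a + 1) * l) := by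
    intro a ha ha'
    have e1 : (a * l + (a + 1) * l) / 2 = (a + 1 / 2) * l := by ring
    have e2 : ((a + 1) * l - a * l) / 2 = l / 2 := by ring
    rw [cos_sub_cos_eq, e1, e2]
    have h1 : Real.sin x / 4 ≤ Real.sin ((a + 1 / 2) * l) :=
      sin_div_four_le_sin hx0 hxpi (by nlinarith) (by rw [← hnl]; nlinarith)
    have h2 : 1 / n ≤ Real.sin (l / 2) := by
      have := Real.mul_le_sin (x := l / 2) (by linarith) (by
        rw [hl]
        have : Real.pi / n ≤ Real.pi := div_le_self hpi.le (by linarith)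
        linarith)
      have e3 : 2 / Real.pi * (l / 2) = 1 / n := by rw [hl]; field_simp
      rwa [e3] at this
    have h0 := Real.sin_nonneg_of_nonneg_of_le_pi hx0 hxpi
    calc Real.sin x / (2 * n) = 2 * (Real.sin x / 4) * (1 / n) := by field_simp; norm_num
      _ ≤ _ := mul_le_mul (by linarith) h2 (by positivity) (by linarith)
  have hcast : ((j - 1 : ℕ) : ℝ) = j - 1 := by rw [Nat.cast_sub hj]; simp
  have h1 := hgap ((j : ℝ) - 1) le_rfl (by linarith)
  have h2 := hgap (j : ℝ) (by linarith) le_rfl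
  have h3 : Real.sin x / (2 * n) ≤ min (chebyshevKnot n j - chebyshevKnot n (j - 1))
      (chebyshevKnot n (j + 1) - chebyshevKnot n j) := by
    unfold chebyshevKnot
    rw [hcast]
    push_cast
    simp only [mul_div_assoc, ← hl]
    rw [sub_add_cancel] at h1
    exact le_min (by linarith) (by linarith)
  unfold halfGap
  have h4 : Real.sin x / (4 * n) = Real.sin x / (2 * n) / 2 := by field_simp; norm_num
  linarith

/-- In the angle variable the new knots are equally spaced by `π/m`. The target interval becomes
`[α, β]` with `ε h ≤ sin((α+β)/2)(β-α)`, while `h ≥ sin((α+β)/2)/(4n)`. The sine cancels and `β - α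
≥ ε/(4n) ≥ π/m`, since `4π < 16`. -/
theorem exists_chebyshevKnot_mem {ε : ℝ} (hε : 0 < ε) {n m j : ℕ} (hm : 16 / ε * n ≤ m)
    (hj : 1 ≤ j) (hjn : j < n) {u : ℝ}
    (hu : chebyshevKnot n j - halfGap (chebyshevKnot n) j ≤ u)
    (hu' : u + ε * halfGap (chebyshevKnot n) j
      ≤ chebyshevKnot n j + halfGap (chebyshevKnot n) j) :
    ∃ i ≤ m, chebyshevKnot m i ∈ Icc u (u + ε * halfGap (chebyshevKnot n) j) := by
  have hn : (0 : ℝ) < n := by exact_mod_cast (Nat.zero_le j).trans_lt hjn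
  have hm0 : (0 : ℝ) < m := lt_of_lt_of_le (by positivity) hm
  have hj1 : (1 : ℝ) ≤ j := by exact_mod_cast hj
  have hjn' : (j : ℝ) + 1 ≤ n := by exact_mod_cast hjn
  have hpi := Real.pi_pos
  have hcast : ((j - 1 : ℕ) : ℝ) = j - 1 := by rw [Nat.cast_sub hj]; simp
  have hlt1 := chebyshevKnot_lt_succ (n := n) (i := j - 1) (by omega)
  rw [show j - 1 + 1 = j by omega] at hlt1
  have hlt2 := chebyshevKnot_lt_succ hjn
  set h := halfGap (chebyshevKnot n) j with hh
  have hh1 : 2 * h ≤ chebyshevKnot n j - chebyshevKnot n (j - 1) := by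
    rw [hh, halfGap]; linarith [min_le_left (chebyshevKnot n j - chebyshevKnot n (j - 1))
      (chebyshevKnot n (j + 1) - chebyshevKnot n j)]
  have hh2 : 2 * h ≤ chebyshevKnot n (j + 1) - chebyshevKnot n j := by
    rw [hh, halfGap]; linarith [min_le_right (chebyshevKnot n j - chebyshevKnot n (j - 1))
      (chebyshevKnot n (j + 1) - chebyshevKnot n j)]
  have hh0 : 0 < h := by
    have : 0 < min (chebyshevKnot n j - chebyshevKnot n (j - 1))
      (chebyshevKnot n (j + 1) - chebyshevKnot n j) := lt_min (by linarith) (by linarith)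
    rw [hh, halfGap]; linarith
  have hεh : 0 < ε * h := by positivity
  set θ₁ : ℝ := ((j : ℝ) - 1) * Real.pi / n with hθ₁
  set θ₂ : ℝ := ((j : ℝ) + 1) * Real.pi / n with hθ₂
  have hz1 : chebyshevKnot n (j - 1) = -Real.cos θ₁ := by rw [chebyshevKnot, hcast]
  have hz2 : chebyshevKnot n (j + 1) = -Real.cos θ₂ := by rw [chebyshevKnot]; push_cast; rfl
  have hθ₁0 : 0 ≤ θ₁ := div_nonneg (mul_nonneg (by linarith) hpi.le) hn.le
  have hθ₂pi : θ₂ ≤ Real.pi := by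
    rw [hθ₂, div_le_iff₀ hn, mul_comm]; exact mul_le_mul_of_nonneg_left hjn' hpi.le
  have hθ : θ₁ ≤ θ₂ := by rw [hθ₁, hθ₂]; gcongr; linarith
  have hcos : ∀ v, -Real.cos θ₁ ≤ v → v ≤ -Real.cos θ₂ →
      Real.cos (Real.arccos (-v)) = -v ∧ Real.arccos (-v) ∈ Icc θ₁ θ₂ := by
    intro v hv hv'
    have e1 : Real.arccos (Real.cos θ₁) = θ₁ := Real.arccos_cos hθ₁0 (hθ.trans hθ₂pi)
    have e2 : Real.arccos (Real.cos θ₂) = θ₂ := Real.arccos_cos (hθ₁0.trans hθ) hθ₂pi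
    refine ⟨Real.cos_arccos ?_ ?_, ?_, ?_⟩
    · linarith [Real.neg_one_le_cos θ₂]
    · linarith [Real.cos_le_one θ₁]
    · rw [← e1]; exact Real.arccos_le_arccos (by linarith)
    · rw [← e2]; exact Real.arccos_le_arccos (by linarith)
  obtain ⟨hα, hα1, hα2⟩ := hcos u (by linarith) (by linarith)
  obtain ⟨hβ, hβ1, hβ2⟩ := hcos (u + ε * h) (by linarith) (by linarith)
  set α := Real.arccos (-u)
  set β := Real.arccos (-(u + ε * h))
  have hαβ : α < β := by
    by_contra hcon
    have := Real.cos_le_cos_of_nonneg_of_le_pi (by linarith) (by linarith) (not_lt.1 hcon)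
    linarith
  have hsin0 : 0 < Real.sin ((α + β) / 2) :=
    Real.sin_pos_of_pos_of_lt_pi (by linarith) (by linarith)
  have hlow := le_halfGap_chebyshevKnot hj hjn (x := (α + β) / 2) (by linarith) (by linarith)
  have hup : ε * h ≤ Real.sin ((α + β) / 2) * (β - α) := by
    have h1 := cos_sub_cos_eq α β
    have h2 : Real.sin ((β - α) / 2) ≤ (β - α) / 2 := Real.sin_le (by linarith)
    nlinarith
  have hlen : Real.pi / m ≤ β - α := by
    have h1 : Real.sin ((α + β) / 2) * (ε / (4 * n)) ≤ Real.sin ((α + β) / 2) * (β - α) := by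
      refine le_trans ?_ hup
      rw [show Real.sin ((α + β) / 2) * (ε / (4 * n))
        = ε * (Real.sin ((α + β) / 2) / (4 * n)) by ring]
      exact mul_le_mul_of_nonneg_left hlow hε.le
    refine le_trans ?_ (le_of_mul_le_mul_left h1 hsin0)
    rw [div_mul_eq_mul_div, div_le_iff₀ hε] at hm
    rw [div_le_div_iff₀ hm0 (by positivity)]
    nlinarith [Real.pi_lt_four]
  set i : ℕ := ⌈α * m / Real.pi⌉₊ with hi
  have h4 : α * m / Real.pi ≤ i := Nat.le_ceil _
  have h5 : (i : ℝ) < α * m / Real.pi + 1 := Nat.ceil_lt_add_one (by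
    have : 0 ≤ α := by linarith
    positivity)
  have h6 : α ≤ i * Real.pi / m := by
    rw [div_le_iff₀ hpi] at h4
    rw [le_div_iff₀ hm0]
    exact h4
  have h7 : i * Real.pi / m ≤ β := by
    have : i * Real.pi / m ≤ α + Real.pi / m := by
      rw [div_le_iff₀ hm0, add_mul, div_mul_cancel₀ _ hm0.ne']
      have := mul_le_mul_of_nonneg_right h5.le hpi.le
      rw [add_mul, div_mul_cancel₀ _ hpi.ne', one_mul] at this
      exact this
    linarith
  refine ⟨i, ?_, ?_, ?_⟩
  · have h8 : i * Real.pi / m ≤ Real.pi := by linarith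
    rw [div_le_iff₀ hm0, mul_comm] at h8
    exact_mod_cast le_of_mul_le_mul_left h8 hpi
  · have := Real.cos_le_cos_of_nonneg_of_le_pi (by linarith) (by linarith) h6
    rw [chebyshevKnot]
    linarith
  · have := Real.cos_le_cos_of_nonneg_of_le_pi (by linarith) (by linarith) h7
    rw [chebyshevKnot]
    linarith

/-! ### Assembling the transitions at all knots. -/

theorem add_sum_Ico_sub (Q : ℕ → ℝ) (k : ℕ) :
    Q 0 + ∑ i ∈ Finset.Ico 1 (k + 1), (Q i - Q (i - 1)) = Q k := by
  induction k with
  | zero => simp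
  | succ k ih =>
    rw [Finset.sum_Ico_succ_top (by omega), ← add_assoc, ih]
    simp

/-- On the `j`-th local interval the earlier transitions are complete and telescope, the later ones
have not started, and only the `j`-th is active. It is used for values and for `q`-th derivatives
alike. -/
theorem add_sum_Ico_eq_of_mem {F Q : ℕ → ℝ} {n j : ℕ} (hj : 1 ≤ j) (hjn : j < n)
    (h₁ : ∀ i, 1 ≤ i → i < j → F i = Q i - Q (i - 1)) (h₂ : ∀ i, j < i → i < n → F i = 0) :
    Q 0 + ∑ i ∈ Finset.Ico 1 n, F i = Q (j - 1) + F j := by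
  rw [← Finset.sum_Ico_consecutive _ hj hjn.le, Finset.sum_eq_sum_Ico_succ_bot hjn,
    Finset.sum_eq_zero (s := Finset.Ico (j + 1) n) fun i hi => by
      rw [Finset.mem_Ico] at hi; exact h₂ i (by omega) hi.2,
    Finset.sum_congr rfl fun i hi => h₁ i (Finset.mem_Ico.1 hi).1 (Finset.mem_Ico.1 hi).2]
  have := add_sum_Ico_sub Q (j - 1)
  rw [show j - 1 + 1 = j by omega] at this
  linarith

theorem add_sum_Ico_eq_right {F Q : ℕ → ℝ} {n : ℕ} (hn : 1 ≤ n)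
    (h : ∀ i, 1 ≤ i → i < n → F i = Q i - Q (i - 1)) :
    Q 0 + ∑ i ∈ Finset.Ico 1 n, F i = Q (n - 1) := by
  rw [Finset.sum_congr rfl fun i hi => h i (Finset.mem_Ico.1 hi).1 (Finset.mem_Ico.1 hi).2]
  have := add_sum_Ico_sub Q (n - 1)
  rwa [show n - 1 + 1 = n by omega] at this

section Knots

variable {n : ℕ} {z : ℕ → ℝ}

theorem knot_le_knot (hz : ∀ i < n, z i < z (i + 1)) {i j : ℕ} (hij : i ≤ j) (hj : j ≤ n) :
    z i ≤ z j := by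
  induction j, hij using Nat.le_induction with
  | base => exact le_rfl
  | succ j _ ih => exact (ih (by omega)).trans (hz j (by omega)).le

theorem halfGap_pos (hz : ∀ i < n, z i < z (i + 1)) {j : ℕ} (hj : 1 ≤ j) (hjn : j < n) :
    0 < halfGap z j := by
  have h1 := hz (j - 1) (by omega)
  rw [show j - 1 + 1 = j by omega] at h1
  have := lt_min (sub_pos.2 h1) (sub_pos.2 (hz j hjn))
  unfold halfGap
  linarith

theorem mid_le_sub_halfGap (z : ℕ → ℝ) (j : ℕ) : (z (j - 1) + z j) / 2 ≤ z j - halfGap z j := by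
  have := min_le_left (z j - z (j - 1)) (z (j + 1) - z j)
  unfold halfGap
  linarith

theorem add_halfGap_le_mid (z : ℕ → ℝ) (j : ℕ) : z j + halfGap z j ≤ (z j + z (j + 1)) / 2 := by
  have := min_le_right (z j - z (j - 1)) (z (j + 1) - z j)
  unfold halfGap
  linarith

/-- Transitions occupy only `3/4` of the half gap, so the inequality is strict even at common
endpoints of local intervals; derivatives can then be read off on a neighbourhood. -/
theorem lt_of_mem_localInterval (hz : ∀ i < n, z i < z (i + 1)) {i j : ℕ} (hi : 1 ≤ i)
    (hij : i < j) (hj : j ≤ n) {x : ℝ} (hx : x ∈ localInterval n z j) :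
    z i + 3 / 4 * halfGap z i < x := by
  have h1 := halfGap_pos hz hi (by omega : i < n)
  have h2 := add_halfGap_le_mid z i
  have h3 := knot_le_knot hz (by omega : i ≤ j - 1) (by omega)
  have h4 := knot_le_knot hz (by omega : i + 1 ≤ j) hj
  have h5 := hx.1
  linarith

theorem gt_of_mem_localInterval (hz : ∀ i < n, z i < z (i + 1)) {i j : ℕ} (hij : j < i)
    (hi : i < n) {x : ℝ} (hx : x ∈ localInterval n z j) :
    x < z i - 3 / 4 * halfGap z i := by
  have h1 := halfGap_pos hz (by omega : 1 ≤ i) hi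
  have h2 := mid_le_sub_halfGap z i
  have h3 := knot_le_knot hz (by omega : j ≤ i - 1) (by omega)
  have h4 := knot_le_knot hz (by omega : j + 1 ≤ i) hi.le
  have h5 := hx.2
  rw [min_eq_left (by omega)] at h5
  linarith

theorem exists_mem_localInterval (h0 : z 0 = -1) (hn : z n = 1) {x : ℝ}
    (hx : x ∈ Icc (-1 : ℝ) 1) : ∃ j ≤ n, x ∈ localInterval n z j := by
  classical
  have hex : ∃ j, x ≤ (z j + z (min (j + 1) n)) / 2 := ⟨n, by
    rw [min_eq_right (by omega), hn]; linarith [hx.2]⟩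
  have hle : Nat.find hex ≤ n := Nat.find_min' hex (by
    rw [min_eq_right (by omega), hn]; linarith [hx.2])
  refine ⟨Nat.find hex, hle, ?_, Nat.find_spec hex⟩
  rcases Nat.eq_zero_or_pos (Nat.find hex) with h | h
  · rw [h, h0]; linarith [hx.1]
  · have := Nat.find_min hex (m := Nat.find hex - 1) (by omega)
    rw [Nat.sub_add_cancel h, min_eq_left hle] at this
    exact (not_le.1 this).le

end Knots

/-- Smoothing of all knots, for general knots whose neighbourhoods contain sufficiently many of
the new knots. -/
theorem exists_smoothing {q r : ℕ} (hq : 1 ≤ q) (hr : 1 ≤ r) : ∃ ε A : ℝ, 0 < ε ∧ 0 < A ∧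
    ∀ (n m : ℕ) (z y : ℕ → ℝ), 1 ≤ n → z 0 = -1 → z n = 1 → (∀ i < n, z i < z (i + 1)) →
    (∀ i < m, y i < y (i + 1)) →
    (∀ j, 1 ≤ j → j < n → ∀ u, z j - halfGap z j ≤ u → u + ε * halfGap z j ≤ z j + halfGap z j →
      ∃ i ≤ m, y i ∈ Icc u (u + ε * halfGap z j)) →
    ∀ s : ℝ → ℝ, IsPiecewisePoly (q + r) n z s → IsQMonotoneOn q s (Icc (-1) 1) →
    ContDiffOn ℝ (q - 1 : ℕ) s (Icc (-1) 1) →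
    ∃ (s' : ℝ → ℝ) (P : ℕ → ℝ[X]), IsMinimalDefectSpline (q + r) m y s' ∧
      IsQMonotoneOn q s' (Icc (-1) 1) ∧
      (∀ i < n, (P i).natDegree ≤ q + r ∧ ∀ x ∈ Icc (z i) (z (i + 1)), s x = (P i).eval x) ∧
      (∀ x ∈ localInterval n z 0, s x - s' x = 0) ∧ (∀ x ∈ localInterval n z n, s x - s' x = 0) ∧
      ∀ j, 1 ≤ j → j < n →
        (∀ x ∈ localInterval n z j, x ∉ Icc (z j - halfGap z j) (z j + halfGap z j) →
          s x - s' x = 0) ∧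
        ∀ x ∈ Icc (z j - halfGap z j) (z j + halfGap z j), |s x - s' x| ≤
          A * coeffNorm (q + r) (rescale (z j) (halfGap z j) (P j - P (j - 1))) := by
  obtain ⟨ε, A, hε, hA, htrans⟩ := exists_transition q hr
  -- The extra 1 pays for the jump itself: to the right of the knot `s` follows the new piece, while
  -- the transition is built on the old one.
  refine ⟨ε, A + 1, hε, by positivity, fun n m z y hn h0 h1 hz hy hdense s hs hmon hsm => ?_⟩
  choose! P hPd hPo using hs
  have hzl : ∀ i ≤ n, -1 ≤ z i := fun i hi => h0 ▸ knot_le_knot hz (Nat.zero_le i) hi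
  have hzr : ∀ i ≤ n, z i ≤ 1 := fun i hi => h1 ▸ knot_le_knot hz hi le_rfl
  -- Both adjacent pieces have the derivatives of `s` at a common knot, so their jump vanishes there
  -- to order `q`.
  have hder : ∀ k < q, ∀ i < n, ∀ x ∈ Icc (z i) (z (i + 1)),
      iteratedDerivWithin k s (Icc (-1) 1) x = (derivative^[k] (P i)).eval x := fun k hk i hi =>
    iteratedDerivWithin_eq_of_eqOn_Ioo hsm (by omega) (hzl i hi.le) (hz i hi) (hzr (i + 1) hi)
      (hPo i hi)
  have hPs : ∀ i < n, ∀ x ∈ Icc (z i) (z (i + 1)), s x = (P i).eval x := by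
    intro i hi x hx
    simpa using hder 0 hq i hi x hx
  have hPq : ∀ i < n, ∀ x ∈ Icc (z i) (z (i + 1)), 0 ≤ (derivative^[q] (P i)).eval x :=
    fun i hi x hx => hmon.iterate_derivative_nonneg (hz i hi)
      (Ioo_subset_Icc_self.trans (Icc_subset_Icc (hzl i hi.le) (hzr (i + 1) hi))) (hPo i hi) hx
  have hsucc : ∀ j, 1 ≤ j → j - 1 + 1 = j := fun j hj => by omega
  have hex : ∀ j, 1 ≤ j ∧ j < n → ∃ a : ℝ → ℝ, ContDiff ℝ (q + r - 1 : ℕ) a ∧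
      (∀ x < z j - 3 / 4 * halfGap z j, a x = 0) ∧
      (∀ x > z j + 3 / 4 * halfGap z j, a x = (P j).eval x - (P (j - 1)).eval x) ∧
      (∀ c e, (∀ t ∈ {t | ∃ i ≤ m, y i = t}, t ∉ Ioo c e) →
        ∃ Q : ℝ[X], Q.natDegree ≤ q + r ∧ ∀ x ∈ Ioo c e, a x = Q.eval x) ∧
      (∀ x ∈ Icc (z j - halfGap z j) (z j + halfGap z j),
        |a x| ≤ A * coeffNorm (q + r) (rescale (z j) (halfGap z j) (P j - P (j - 1)))) ∧
      ∀ x ∈ Icc (z j - halfGap z j) (z j + halfGap z j),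
        0 ≤ (derivative^[q] (P (j - 1))).eval x + iteratedDeriv q a x := by
    rintro j ⟨hj, hjn⟩
    have hprev := hz (j - 1) (by omega)
    rw [hsucc j hj] at hprev
    have hnext := hz j hjn
    have hpos := halfGap_pos hz hj hjn
    have hml := mid_le_sub_halfGap z j
    have hmr := add_halfGap_le_mid z j
    refine htrans {t | ∃ i ≤ m, y i = t} (z j) (halfGap z j) hpos ?_ (P (j - 1)) (P j)
      (hPd _ (by omega)) (hPd j hjn) ?_ ?_ ?_
    · intro u hu hu'
      obtain ⟨i, hi, hiu⟩ := hdense j hj hjn u hu hu'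
      exact ⟨y i, ⟨i, hi, rfl⟩, hiu⟩
    · intro k hk
      have e1 := hder k hk (j - 1) (by omega) (z j)
        (by rw [hsucc j hj]; exact ⟨hprev.le, le_rfl⟩)
      have e2 := hder k hk j hjn (z j) ⟨le_rfl, hnext.le⟩
      rw [← e1, e2]
    · intro x hx
      exact hPq (j - 1) (by omega) x (by rw [hsucc j hj]; exact ⟨by linarith [hx.1], hx.2⟩)
    · intro x hx
      exact hPq j hjn x ⟨hx.1, by linarith [hx.2]⟩
  choose! a hcd hleft hright hpw hbd hnn using hex
  have hmemIco : ∀ {i}, i ∈ Finset.Ico 1 n → 1 ≤ i ∧ i < n := fun hi => Finset.mem_Ico.1 hi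
  let s' : ℝ → ℝ := fun x => (P 0).eval x + ∑ i ∈ Finset.Ico 1 n, a i x
  have hs'cd : ContDiff ℝ (q + r - 1 : ℕ) s' :=
    (contDiff_polynomial_eval _ _).add (ContDiff.sum fun i hi => hcd i (hmemIco hi))
  have hqle : ((q : ℕ) : WithTop ℕ∞) ≤ (q + r - 1 : ℕ) := by
    exact_mod_cast (by omega : q ≤ q + r - 1)
  have hs'der : ∀ x, iteratedDeriv q s' x
      = (derivative^[q] (P 0)).eval x + ∑ i ∈ Finset.Ico 1 n, iteratedDeriv q (a i) x := by
    intro x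
    have e1 := iteratedDeriv_add (n := q) (x := x) (f := fun x => (P 0).eval x)
      (g := fun x => ∑ i ∈ Finset.Ico 1 n, a i x) (contDiff_polynomial_eval _ _).contDiffAt
      (ContDiff.sum fun i hi => (hcd i (hmemIco hi)).of_le hqle).contDiffAt
    rw [iteratedDeriv_fun_sum fun i hi => ((hcd i (hmemIco hi)).of_le hqle).contDiffAt,
      iteratedDeriv_polynomial_eval] at e1
    exact e1
  have hderleft : ∀ i, 1 ≤ i ∧ i < n → ∀ x < z i - 3 / 4 * halfGap z i,
      iteratedDeriv q (a i) x = 0 := by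
    intro i hi x hx
    have e1 : a i =ᶠ[nhds x] fun _ => 0 := by
      filter_upwards [Iio_mem_nhds hx] with w hw using hleft i hi w hw
    rw [e1.iteratedDeriv_eq, iteratedDeriv_fun_const_zero]
  have hderright : ∀ i, 1 ≤ i ∧ i < n → ∀ x > z i + 3 / 4 * halfGap z i,
      iteratedDeriv q (a i) x
        = (derivative^[q] (P i)).eval x - (derivative^[q] (P (i - 1))).eval x := by
    intro i hi x hx
    have e1 : a i =ᶠ[nhds x] fun x => (P i - P (i - 1)).eval x := by
      filter_upwards [Ioi_mem_nhds hx] with w hw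
      rw [eval_sub]
      exact hright i hi w hw
    rw [e1.iteratedDeriv_eq, iteratedDeriv_polynomial_eval, iterate_derivative_sub]
    exact eval_sub (R := ℝ) ..
  have hval0 : ∀ x ∈ localInterval n z 0, s' x = (P 0).eval x := fun x hx => by
    simp only [s']
    rw [Finset.sum_eq_zero fun i hi => hleft i (hmemIco hi) x
      (gt_of_mem_localInterval hz (hmemIco hi).1 (hmemIco hi).2 hx), add_zero]
  have hvaln : ∀ x ∈ localInterval n z n, s' x = (P (n - 1)).eval x := fun x hx =>
    add_sum_Ico_eq_right (F := fun i => a i x) (Q := fun i => (P i).eval x) hn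
      fun i hi hin => hright i ⟨hi, hin⟩ x (lt_of_mem_localInterval hz hi hin le_rfl hx)
  have hvalj : ∀ j, 1 ≤ j → j < n → ∀ x ∈ localInterval n z j,
      s' x = (P (j - 1)).eval x + a j x := fun j hj hjn x hx =>
    add_sum_Ico_eq_of_mem (F := fun i => a i x) (Q := fun i => (P i).eval x) hj hjn
      (fun i hi hij => hright i ⟨hi, by omega⟩ x (lt_of_mem_localInterval hz hi hij hjn.le hx))
      (fun i hij hi => hleft i ⟨by omega, hi⟩ x (gt_of_mem_localInterval hz hij hi hx))
  have hder0 : ∀ x ∈ localInterval n z 0, iteratedDeriv q s' x = (derivative^[q] (P 0)).eval x :=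
    fun x hx => by
      rw [hs'der, Finset.sum_eq_zero fun i hi => hderleft i (hmemIco hi) x
        (gt_of_mem_localInterval hz (hmemIco hi).1 (hmemIco hi).2 hx), add_zero]
  have hdern : ∀ x ∈ localInterval n z n,
      iteratedDeriv q s' x = (derivative^[q] (P (n - 1))).eval x := fun x hx => by
    rw [hs'der]
    exact add_sum_Ico_eq_right (F := fun i => iteratedDeriv q (a i) x)
      (Q := fun i => (derivative^[q] (P i)).eval x) hn
      fun i hi hin => hderright i ⟨hi, hin⟩ x (lt_of_mem_localInterval hz hi hin le_rfl hx)
  have hderj : ∀ j, 1 ≤ j → j < n → ∀ x ∈ localInterval n z j,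
      iteratedDeriv q s' x
        = (derivative^[q] (P (j - 1))).eval x + iteratedDeriv q (a j) x := fun j hj hjn x hx => by
    rw [hs'der]
    exact add_sum_Ico_eq_of_mem (F := fun i => iteratedDeriv q (a i) x)
      (Q := fun i => (derivative^[q] (P i)).eval x) hj hjn
      (fun i hi hij => hderright i ⟨hi, by omega⟩ x (lt_of_mem_localInterval hz hi hij hjn.le hx))
      (fun i hij hi => hderleft i ⟨by omega, hi⟩ x (gt_of_mem_localInterval hz hij hi hx))
  have hJ0 : ∀ x ∈ localInterval n z 0, x ∈ Icc (z 0) (z (0 + 1)) := by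
    intro x hx
    have h2 := hz 0 (by omega)
    have h3 := hx.1
    have h4 := hx.2
    rw [min_eq_left (by omega)] at h4
    simp only [Nat.zero_sub] at h3
    exact ⟨by linarith, by linarith⟩
  have hJn : ∀ x ∈ localInterval n z n, x ∈ Icc (z (n - 1)) (z (n - 1 + 1)) := by
    intro x hx
    have h2 := hz (n - 1) (by omega)
    have h3 := hx.1
    have h4 := hx.2
    rw [min_eq_right (by omega)] at h4
    rw [hsucc n hn] at h2 ⊢
    exact ⟨by linarith, by linarith⟩
  have hJl : ∀ j, 1 ≤ j → j < n → ∀ x, (z (j - 1) + z j) / 2 ≤ x → x ≤ z j →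
      x ∈ Icc (z (j - 1)) (z (j - 1 + 1)) := by
    intro j hj hjn x hx hx'
    have h2 := hz (j - 1) (by omega)
    rw [hsucc j hj] at h2 ⊢
    exact ⟨by linarith, hx'⟩
  have hJr : ∀ j, 1 ≤ j → j < n → ∀ x, z j ≤ x → x ≤ (z j + z (j + 1)) / 2 →
      x ∈ Icc (z j) (z (j + 1)) := by
    intro j hj hjn x hx hx'
    have h2 := hz j hjn
    exact ⟨hx, by linarith⟩
  refine ⟨s', P, ⟨?_, ?_⟩, ?_, fun i hi => ⟨hPd i hi, hPs i hi⟩, ?_, ?_, ?_⟩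
  · intro k hk
    have hfree : ∀ t ∈ {t | ∃ i ≤ m, y i = t}, t ∉ Ioo (y k) (y (k + 1)) := by
      rintro t ⟨i, hi, rfl⟩ hmem
      rcases le_or_gt i k with h | h
      · exact absurd hmem.1 (not_lt.2 (knot_le_knot hy h hk.le))
      · exact absurd hmem.2 (not_lt.2 (knot_le_knot hy h hi))
    have hQ : ∀ i, 1 ≤ i ∧ i < n → ∃ Q : ℝ[X], Q.natDegree ≤ q + r ∧
        ∀ x ∈ Ioo (y k) (y (k + 1)), a i x = Q.eval x := fun i hi => hpw i hi _ _ hfree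
    choose! Q hQd hQe using hQ
    refine ⟨P 0 + ∑ i ∈ Finset.Ico 1 n, Q i, ?_, fun x hx => ?_⟩
    · exact natDegree_add_le_of_degree_le (hPd 0 (by omega))
        (natDegree_sum_le_of_forall_le _ _ fun i hi => hQd i (hmemIco hi))
    · rw [eval_add, eval_finsetSum]
      exact congrArg _ (Finset.sum_congr rfl fun i hi => hQe i (hmemIco hi) x hx)
  · intro k hk
    exact (hs'cd.of_le (by exact_mod_cast (by omega : k ≤ q + r - 1))).contDiffOn
  · refine isQMonotoneOn_of_iteratedDeriv_nonneg (hs'cd.of_le hqle) fun x hx => ?_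
    obtain ⟨j, hjn, hxj⟩ := exists_mem_localInterval h0 h1 hx
    rcases Nat.eq_zero_or_pos j with rfl | hj
    · rw [hder0 x hxj]
      exact hPq 0 (by omega) x (hJ0 x hxj)
    rcases hjn.eq_or_lt with rfl | hjn
    · rw [hdern x hxj]
      exact hPq _ (by omega) x (hJn x hxj)
    have hpos := halfGap_pos hz hj hjn
    have hxl := hxj.1
    have hxr := hxj.2
    rw [min_eq_left (by omega)] at hxr
    rw [hderj j hj hjn x hxj]
    rcases lt_or_ge x (z j - halfGap z j) with h | h
    · rw [hderleft j ⟨hj, hjn⟩ x (by linarith), add_zero]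
      exact hPq _ (by omega) x (hJl j hj hjn x hxl (by linarith))
    rcases lt_or_ge (z j + halfGap z j) x with h' | h'
    · rw [hderright j ⟨hj, hjn⟩ x (by linarith), add_sub_cancel]
      exact hPq j hjn x (hJr j hj hjn x (by linarith) hxr)
    · exact hnn j ⟨hj, hjn⟩ x ⟨h, h'⟩
  · intro x hx
    rw [hval0 x hx, hPs 0 (by omega) x (hJ0 x hx), sub_self]
  · intro x hx
    rw [hvaln x hx, hPs (n - 1) (by omega) x (hJn x hx), sub_self]
  · intro j hj hjn
    have hpos := halfGap_pos hz hj hjn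
    have hml := mid_le_sub_halfGap z j
    have hmr := add_halfGap_le_mid z j
    refine ⟨fun x hx hxn => ?_, fun x hx => ?_⟩
    · have hxl := hx.1
      have hxr := hx.2
      rw [min_eq_left (by omega)] at hxr
      rw [hvalj j hj hjn x hx]
      rcases lt_or_ge x (z j - halfGap z j) with h | h
      · rw [hleft j ⟨hj, hjn⟩ x (by linarith), add_zero,
          hPs _ (by omega) x (hJl j hj hjn x hxl (by linarith)), sub_self]
      · have h' : z j + halfGap z j < x := by
          by_contra h2
          exact hxn ⟨h, not_lt.1 h2⟩
        rw [hright j ⟨hj, hjn⟩ x (by linarith), add_sub_cancel,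
          hPs j hjn x (hJr j hj hjn x (by linarith) hxr), sub_self]
    · have hxJ : x ∈ localInterval n z j := by
        refine ⟨by linarith [hx.1], ?_⟩
        rw [min_eq_left (by omega)]
        linarith [hx.2]
      have hxl := hxJ.1
      have hxr := hxJ.2
      rw [min_eq_left (by omega)] at hxr
      set M := coeffNorm (q + r) (rescale (z j) (halfGap z j) (P j - P (j - 1))) with hM
      have ha := hbd j ⟨hj, hjn⟩ x hx
      rw [hvalj j hj hjn x hxJ]
      rcases le_total x (z j) with h | h
      · rw [hPs _ (by omega) x (hJl j hj hjn x hxl h), sub_add_cancel_left, abs_neg]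
        linarith [coeffNorm_nonneg (q + r) (rescale (z j) (halfGap z j) (P j - P (j - 1)))]
      · have hD : |(P j).eval x - (P (j - 1)).eval x| ≤ M := by
          have e1 : (P j).eval x - (P (j - 1)).eval x
              = (rescale (z j) (halfGap z j) (P j - P (j - 1))).eval ((x - z j) / halfGap z j) := by
            rw [eval_rescale, mul_div_cancel₀ _ hpos.ne', sub_add_cancel, eval_sub]
          rw [e1]
          refine abs_eval_le_coeffNorm (natDegree_rescale_le
            ((natDegree_sub_le _ _).trans (max_le (hPd j hjn) (hPd _ (by omega))))) ?_
          rw [abs_div, abs_of_pos hpos, div_le_one hpos]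
          exact abs_le.2 ⟨by linarith [hx.1], by linarith [hx.2]⟩
        rw [hPs j hjn x (hJr j hj hjn x h hxr), ← sub_sub]
        refine (abs_sub _ _).trans ?_
        linarith

/-! ### Comparison of constants and conclusion. -/

/-- In the quotient of the error bound by the lower bound of the modulus, `M` and `h` cancel, so the
constant depends only on the exponent besides `A`, `b`, `ρ`. -/
theorem rpow_const_mul_le {A b M ρ h e : ℝ} (hA : 0 < A) (hb : 0 < b) (hM : 0 ≤ M) (hρ : 0 < ρ)
    (hh : 0 < h) :
    ENNReal.ofReal (A * M) * ENNReal.ofReal (2 * h) ^ e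
      ≤ ((A / b * (2 / ρ) ^ e).toNNReal : ℝ≥0∞) *
        (ENNReal.ofReal (b * M) * ENNReal.ofReal (ρ * h) ^ e) := by
  rw [ENNReal.ofReal_rpow_of_pos (by positivity), ENNReal.ofReal_rpow_of_pos (by positivity),
    ← ENNReal.ofReal_mul (by positivity), ← ENNReal.ofReal_mul (by positivity),
    show ((A / b * (2 / ρ) ^ e).toNNReal : ℝ≥0∞) = ENNReal.ofReal (A / b * (2 / ρ) ^ e) from rfl,
    ← ENNReal.ofReal_mul (by positivity)]
  refine ENNReal.ofReal_le_ofReal (le_of_eq ?_)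
  have h1 : (2 * h) ^ e = (2 / ρ) ^ e * (ρ * h) ^ e := by
    rw [← Real.mul_rpow (by positivity) (by positivity)]
    congr 1
    field_simp
  rw [h1]
  field_simp

end SplineSmoothing

theorem corollary1p3 (q r : ℕ) (hq : 1 ≤ q) (hr : 1 ≤ r) :
    ∃ (m₀ : ℝ) (c : ℝ≥0∞ → ℝ≥0), 0 < m₀ ∧
      ∀ Z : ℕ → ℕ → ℝ,
        (Z = SplineSmoothing.uniformKnot ∨ Z = SplineSmoothing.chebyshevKnot) →
      ∀ n : ℕ, 1 ≤ n → ∀ s : ℝ → ℝ,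
        SplineSmoothing.IsPiecewisePoly (q + r) n (Z n) s →
        SplineSmoothing.IsQMonotoneOn q s (Icc (-1) 1) →
        ContDiffOn ℝ (q - 1 : ℕ) s (Icc (-1) 1) →
        ∀ m : ℕ, m₀ * n ≤ m →
          ∃ s' : ℝ → ℝ,
            SplineSmoothing.IsMinimalDefectSpline (q + r) m (Z m) s' ∧
            SplineSmoothing.IsQMonotoneOn q s' (Icc (-1) 1) ∧
            ∀ p : ℝ≥0∞, 0 < p → ∀ j ≤ n,
              SplineSmoothing.LpNormOn (fun x => s x - s' x) p
                  (SplineSmoothing.localInterval n (Z n) j) ≤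
                c p * SplineSmoothing.localModulus (q + r + 1) s
                  (SplineSmoothing.localInterval n (Z n) j) p := by
  open SplineSmoothing in
  obtain ⟨ε, A, hε, hA, hsmooth⟩ := exists_smoothing hq hr
  obtain ⟨b, ρ, hb, hρ, hmod⟩ := exists_jump_le_localModulus (q + r)
  -- For `p = ∞`, `p.toReal = 0` and the exponent becomes 0, which is the correct sup-norm constant
  -- `A / b`.
  refine ⟨16 / ε, fun p => (A / b * (2 / ρ) ^ (1 / p.toReal)).toNNReal, by positivity, ?_⟩
  intro Z hZ n hn s hs hmon hsm m hm
  have hZ0 : Z n 0 = -1 := by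
    rcases hZ with rfl | rfl
    exacts [uniformKnot_zero n, chebyshevKnot_zero n]
  have hZ1 : Z n n = 1 := by
    rcases hZ with rfl | rfl
    exacts [uniformKnot_self hn, chebyshevKnot_self hn]
  have hZlt : ∀ k, ∀ i < k, Z k i < Z k (i + 1) := by
    rcases hZ with rfl | rfl
    exacts [fun _ _ => uniformKnot_lt_succ, fun _ _ => chebyshevKnot_lt_succ]
  have hdense : ∀ j, 1 ≤ j → j < n → ∀ u, Z n j - halfGap (Z n) j ≤ u →
      u + ε * halfGap (Z n) j ≤ Z n j + halfGap (Z n) j →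
      ∃ i ≤ m, Z m i ∈ Icc u (u + ε * halfGap (Z n) j) := by
    rcases hZ with rfl | rfl
    exacts [fun _ hj hjn _ => exists_uniformKnot_mem hε hm hj hjn,
      fun _ hj hjn _ => exists_chebyshevKnot_mem hε hm hj hjn]
  obtain ⟨s', P, hspl, hmon', hP, h0, h1, hj⟩ :=
    hsmooth n m (Z n) (Z m) hn hZ0 hZ1 (hZlt n) (hZlt m) hdense s hs hmon hsm
  refine ⟨s', hspl, hmon', fun p hp j hjn => ?_⟩
  have hzero : (∀ x ∈ localInterval n (Z n) j, s x - s' x = 0) →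
      LpNormOn (fun x => s x - s' x) p (localInterval n (Z n) j) = 0 := fun h => by
    have hae : (fun x => s x - s' x) =ᵐ[volume.restrict (localInterval n (Z n) j)] 0 :=
      ae_restrict_of_forall_mem measurableSet_Icc fun x hx => h x hx
    rw [LpNormOn, eLpNorm_congr_ae hae, eLpNorm_zero]
  rcases Nat.eq_zero_or_pos j with rfl | hj1
  · rw [hzero h0]; exact zero_le
  rcases hjn.eq_or_lt with rfl | hjn
  · rw [hzero h1]; exact zero_le
  obtain ⟨hout, hin⟩ := hj j hj1 hjn
  have hpos := halfGap_pos (hZlt n) hj1 hjn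
  have hml := mid_le_sub_halfGap (Z n) j
  have hmr := add_halfGap_le_mid (Z n) j
  have hprev := hZlt n (j - 1) (by omega)
  have hnext := hZlt n j hjn
  have hM := coeffNorm_nonneg (q + r) (rescale (Z n j) (halfGap (Z n) j) (P j - P (j - 1)))
  rw [Nat.sub_add_cancel hj1] at hprev
  refine (LpNormOn_le_of_abs_le (mul_nonneg hA.le hM) hout hin p).trans
    ((rpow_const_mul_le hA hb hM hρ hpos).trans (mul_le_mul_right ?_ _))
  refine hmod _ _ (Z n j) (halfGap (Z n) j) s (P (j - 1)) (P j) hpos hml ?_ (hP _ (by omega)).1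
    (hP j hjn).1 ?_ ?_ p hp
  · rw [min_eq_left (by omega)]; exact hmr
  · intro x hx
    refine (hP (j - 1) (by omega)).2 x ?_
    rw [Nat.sub_add_cancel hj1]
    exact ⟨by linarith [hx.1], hx.2⟩
  · intro x hx
    exact (hP j hjn).2 x ⟨hx.1, by linarith [hx.2]⟩
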